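/- **Setting.** Let $(E,\mathcal E,\nu)$ be a probability space, $f:E\to[0,\infty)$ measurable, $c>0$, $S=\{(x,y)\in E\times\mathbb R:0\le y\le f(x)\}$. For each $n$ let $N_n$ be a Poisson point process on $E\times\mathbb R$ with intensity measure $nc\,(\nu\otimes\lambda)\mathbf 1_S$, where $\lambda$ is Lebesgue measure, and let $(X_{n,i},Y_{n,i})$ be its points. Let $\{I_{n,r}:1\le r\le k_n\}$ be a measurable partition of $E$ with $\nu(I_{n,r})=k_n^{-1}$ for all $r$, let $D_{n,r}=\{(x,y)\in S:x\in I_{n,r}\}$, $N_{n,r}=N_n(D_{n,r})$, and let $Y^*_{n,r}$ be the maximum of the $Y_{n,i}$ with $(X_{n,i},Y_{n,i})\in D_{n,r}$ if $N_{n,r}\ne0$, and $Y_{n,r}^*=0$ otherwise; $(1+N_{n,r}^{-1})Y^*_{n,r}$ is read as $0$ if $N_{n,r}=0$. For $K_n:E\times E\to\mathbb R$ define $$\bar f_n(t)=\sum_{r=1}^{k_n}\mathbf 1_{I_{n,r}}(t)(1+N_{n,r}^{-1})Y^*_{n,r},\qquad \hat f_n(x)=\int_E K_n(x,t)\bar f_n(t)\,\nu(dt),$$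 $$\tilde f_n(x)=\sum_{r=1}^{k_n}\nu(I_{n,r})K_n(x,x_{n,r})(1+N_{n,r}^{-1})Y^*_{n,r}\quad\text{with } x_{n,r}\in I_{n,r},$$ $$\hat a_n=\sum_{r=1}^{k_n}\nu(I_{n,r})(1+N_{n,r}^{-1})Y_{n,r}^*,\qquad \hat c_n=\frac{N_n(S)}{n\hat a_n}.$$ Let $\Delta_n$ be the largest $\nu$-essential oscillation of $f$ on a cell $I_{n,r}$, $\|\cdot\|_1,\|\cdot\|_2,\langle\cdot,\cdot\rangle_2$ the norms and the inner product of $L^1(\nu)$, $L^2(\nu)$, $\|g\|_E=\sup_E|g|$, and $$\Gamma_n(x)=\max_{r\le k_n}\sup_{s,t\in I_{n,r}}(K_n(x,t)-K_n(x,s)),\qquad \Psi_n(x)=\Big|\int_E K_n(x,t)f(t)\,\nu(dt)-f(x)\Big|.$$ Let $F\subset E$ and $\sigma:E\times E\to\mathbb R$. Assume that for $x\in F$ the function $K_n(x,\cdot)$ is integrable for every $n$, and, for all large $n$, bounded with $\|K_n(x,\cdot)\|_2>0$. Consider the following conditions, where limits are as $n\to\infty$: - (H'.1) $k_n\uparrow\infty$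 and $n^{-1}k_n\log n\to0$. - (H.2) $0<m\le M<\infty$, where $m,M$ are the $\nu$-essential infimum and supremum of $f$, and $nk_n^{-1}\Delta_n\to0$. - (K.0) $\int_{E\times E}|K_n(x,t)|\,\nu(dx)\nu(dt)<\infty$ for all $n\ge1$. - (K.1) $\Gamma_n(x_1)\|K_n(x_2,\cdot)\|_1=o\big(\|K_n(x_1,\cdot)\|_2\|K_n(x_2,\cdot)\|_2\big)$ for all $x_1,x_2\in F$. - (K.2) $\langle K_n(x_1,\cdot),K_n(x_2,\cdot)\rangle_2\big(\|K_n(x_1,\cdot)\|_2\|K_n(x_2,\cdot)\|_2\big)^{-1}\to\sigma(x_1,x_2)$ for all $x_1,x_2\in F$. - (K.3) $k_n^{-1/2}\|K_n(x,\cdot)\|_2^{-1}\|K_n(x,\cdot)\|_E\to0$ for all $x\in F$. - (K.4) $nk_n^{-1/2}\|K_n(x,\cdot)\|_2^{-1}\max\big(\Psi_n(x),\Delta_n\|K_n(x,\cdot)\|_1\big)\to0$ for all $x\in F$. - (K.5) $nk_n^{-1/2}\|K_n(x,\cdot)\|_2^{-1}\sum_{r=1}^{k_n}\Big|\int_{I_{n,r}}\big(K_n(x,t)-K_n(x,x_{n,r})\big)\,\nu(dt)\Big|\to0$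 for all $x\in F$. **Theorem.** Assume (H'.1), (H.2) and (K.0)–(K.4). For $x_1,\dots,x_p\in F$ the matrix $\Sigma_{(x_1,\dots,x_p)}=[\sigma(x_i,x_j)]_{1\le i,j\le p}$ is a covariance matrix (positive semidefinite), and: (a) for all $x_1,\dots,x_p\in F$, $$\Big\{nc\,k_n^{-1/2}\|K_n(x_j,\cdot)\|_2^{-1}\big(\hat f_n(x_j)-f(x_j)\big):1\le j\le p\Big\}\xrightarrow{\ \mathcal D\ }N\big(0,\Sigma_{(x_1,\dots,x_p)}\big);$$ (b) if moreover (K.5) holds, then for all $x_1,\dots,x_p\in F$, $$\Big\{nc\,k_n^{-1/2}\|K_n(x_j,\cdot)\|_2^{-1}\big(\tilde f_n(x_j)-f(x_j)\big):1\le j\le p\Big\}\xrightarrow{\ \mathcal D\ }N\big(0,\Sigma_{(x_1,\dots,x_p)}\big);$$ (c) the convergences in (a) and (b) also hold, under the respective assumptions, when $c$ is replaced by $\hat c_n$. -/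

import Mathlib

open MeasureTheory ProbabilityTheory Filter Topology Asymptotics

noncomputable section

namespace PoissonBoundary

/-! ### Finite point processes and Poisson processes -/

/-- A point process with finitely many points: `pt i ω` for `i < card ω` are the points of the
configuration `ω` (the values `pt i ω` with `card ω ≤ i` play no role). -/
structure PointProcess (Ω X : Type*) [MeasurableSpace Ω] [MeasurableSpace X] where
  card : Ω → ℕ
  pt : ℕ → Ω → X
  measurable_card : Measurable card
  measurable_pt : ∀ i, Measurable (pt i)

open Classical in
/-- `N(D)`: the number of points, with multiplicity, that lie in `D`. -/
def PointProcess.count {Ω X : Type*} [MeasurableSpace Ω] [MeasurableSpace X]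
    (N : PointProcess Ω X) (D : Set X) (ω : Ω) : ℕ :=
  ((Finset.range (N.card ω)).filter (fun i => N.pt i ω ∈ D)).card

/-- `N` is a Poisson point process with intensity measure `Λ` under `P`. -/
structure PointProcess.IsPoisson {Ω X : Type*} [MeasurableSpace Ω] [MeasurableSpace X]
    (N : PointProcess Ω X) (P : Measure Ω) (Λ : Measure X) : Prop where
  hasLaw_count : ∀ D : Set X, MeasurableSet D → Λ D ≠ ⊤ →
    HasLaw (N.count D) (poissonMeasure (Λ D).toNNReal) P
  iIndepFun_count : ∀ (q : ℕ) (D : Fin q → Set X), (∀ i, MeasurableSet (D i)) →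
    Pairwise (fun i j => Disjoint (D i) (D j)) → iIndepFun (fun i => N.count (D i)) P

/-! ### The model -/

variable {E : Type*} [MeasurableSpace E]

/-- The part of `{(x, y) : 0 ≤ y ≤ f x}` above `A`; for `A = Set.univ` it is the whole set `S`. -/
def hypograph (f : E → ℝ) (A : Set E) : Set (E × ℝ) :=
  {q | q.1 ∈ A ∧ 0 ≤ q.2 ∧ q.2 ≤ f q.1}

/-- The intensity measure `b (ν ⊗ λ) 1_S`. -/
def intensity (ν : Measure E) (f : E → ℝ) (b : ℝ) : Measure (E × ℝ) :=
  ENNReal.ofReal b • (ν.prod volume).restrict (hypograph f Set.univ)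

/-- A finite measurable partition of `E` in cells of mass `1 / k`. -/
structure IsEqualMassPartition (ν : Measure E) {k : ℕ} (I : Fin k → Set E) : Prop where
  measurableSet : ∀ r, MeasurableSet (I r)
  disjoint : Pairwise (fun r s => Disjoint (I r) (I s))
  iUnion_eq : ⋃ r, I r = Set.univ
  mass : ∀ r, ν.real (I r) = (k : ℝ)⁻¹

/-- `Δ`: the largest `ν`-essential oscillation of `f` on a cell. -/
def cellOsc (ν : Measure E) (f : E → ℝ) {k : ℕ} (I : Fin k → Set E) : ℝ :=
  ⨆ r, (essSup f (ν.restrict (I r)) - essInf f (ν.restrict (I r)))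

/-! ### The estimators -/

section Estimators

variable {Ω : Type*} [MeasurableSpace Ω] (N : PointProcess Ω (E × ℝ))

/-- The largest second coordinate of a point of the process in `D`; it is `0` if there is none
(the supremum of the empty set of reals is `0`). -/
def maxHeight (D : Set (E × ℝ)) (ω : Ω) : ℝ :=
  sSup {y | ∃ i < N.card ω, N.pt i ω ∈ D ∧ (N.pt i ω).2 = y}

/-- The bias corrected maximum `(1 + 1 / N(D)) Y*` for the cell `D` of `S` above `A`; it is `0` if
`N(D) = 0`. -/
def correctedMax (f : E → ℝ) (A : Set E) (ω : Ω) : ℝ :=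
  (1 + 1 / (N.count (hypograph f A) ω : ℝ)) * maxHeight N (hypograph f A) ω

/-- The bias corrected Geffroy estimator. -/
def geffroy (f : E → ℝ) {k : ℕ} (I : Fin k → Set E) (t : E) (ω : Ω) : ℝ :=
  ∑ r, (I r).indicator (fun _ => correctedMax N f (I r) ω) t

/-- The kernel estimator `∫ K(x, t) f̄(t) ν(dt)`. -/
def kernelEstimator (ν : Measure E) (f : E → ℝ) {k : ℕ} (I : Fin k → Set E) (K : E → E → ℝ)
    (x : E) (ω : Ω) : ℝ :=
  ∫ t, K x t * geffroy N f I t ω ∂ν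

/-- The simplified kernel estimator, with nodes `ξ r` in the cells. -/
def simplifiedEstimator (ν : Measure E) (f : E → ℝ) {k : ℕ} (I : Fin k → Set E) (K : E → E → ℝ)
    (ξ : Fin k → E) (x : E) (ω : Ω) : ℝ :=
  ∑ r, ν.real (I r) * K x (ξ r) * correctedMax N f (I r) ω

/-- The estimator `â` of `∫ f dν`. -/
def aHat (ν : Measure E) (f : E → ℝ) {k : ℕ} (I : Fin k → Set E) (ω : Ω) : ℝ :=
  ∑ r, ν.real (I r) * correctedMax N f (I r) ω

/-- The estimator `ĉ = N(S) / (n â)` of `c`. -/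
def cHat (ν : Measure E) (f : E → ℝ) {k : ℕ} (I : Fin k → Set E) (n : ℕ) (ω : Ω) : ℝ :=
  (N.count (hypograph f Set.univ) ω : ℝ) / (n * aHat N ν f I ω)

end Estimators

/-! ### Quantities attached to a kernel -/

/-- `‖g‖₁` -/
def norm1 (ν : Measure E) (g : E → ℝ) : ℝ := ∫ t, |g t| ∂ν

/-- `‖g‖₂` -/
def norm2 (ν : Measure E) (g : E → ℝ) : ℝ := √(∫ t, g t ^ 2 ∂ν)

/-- `‖g‖_E`, the supremum norm -/
def normSup (g : E → ℝ) : ℝ := ⨆ t, |g t|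

/-- `Γ(x)`: the largest oscillation of `g = K(x, ·)` on a cell. -/
def Gam {k : ℕ} (I : Fin k → Set E) (g : E → ℝ) : ℝ :=
  sSup {d | ∃ r, ∃ s ∈ I r, ∃ t ∈ I r, d = g t - g s}

/-- `Ψ(x) = |∫ K(x, t) f(t) ν(dt) - f(x)|` -/
def Psi (ν : Measure E) (f : E → ℝ) (K : E → E → ℝ) (x : E) : ℝ :=
  |(∫ t, K x t * f t ∂ν) - f x|

end PoissonBoundary

end

open PoissonBoundary

/-! Dividing heights by `f` turns the process above a cell `I` into a Poisson number `N` of points,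
of mean `lam = n c ∫_I f`, with independent uniform relative heights. Their maximum `W` satisfies
`P(N = j, W ≤ w) = e^{-lam} lam^j w^j / j!` (`isCellPair`). Given `N = j ≥ 1` the mean of `W` is `j
/ (j + 1)`, so `(1 + 1/N) W` has conditional mean exactly `1`: this is the point of the bias
correction. Hence `V = lam ((1 + 1/N) W - 1)` has mean `-lam e^{-lam}`, due to empty cells alone,
second moment `1 + O(1/lam)` and bounded fourth moment. Over disjoint cells the `V_r` are
independent (`iIndepFun_fluctuation`).

Since `f` oscillates by at most `Δ` on a cell, the corrected maximum there is `a_r + (k / (n c))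
V_r` up to `2 Δ`, with `a_r` the cell mean of `f`. Both estimators are linear combinations of
corrected maxima. After standardisation their error is `∑ w_r V_r`, with `w_r = √k ‖K(x,·)‖₂⁻¹
∫_{I_r} K(x,·)`, plus a remainder that is almost surely below a deterministic null sequence
(`ae_abs_weighted_sum_sub_le`).

The sums converge by comparing characteristic functions (`tendstoInDistribution_weighted_sum`). The
sup-norm condition makes the weights uniformly small. The conditions on oscillations and inner
products make their Gram matrices converge to `σ` (`tendsto_sum_cellWeight_mul`), which also shows
that the limit is positive semidefinite. The logarithmic growth condition makes the total mean
negligible. Finally `ĉ / c → 1` in probability (`tendsto_measure_cHat`), and Slutsky's theorem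
allows `c` to be estimated. -/

noncomputable section

set_option linter.unusedSectionVars false

namespace PoissonBoundary

/-! ### Counts and largest marks of a finite point process -/

section PointProcesses

variable {Ω X : Type*} [MeasurableSpace Ω] [MeasurableSpace X]

/-- The largest value of `g` at a point of the process in `D`; it is `0` if there is none. -/
def maxMark (N : PointProcess Ω X) (g : X → ℝ) (D : Set X) (ω : Ω) : ℝ :=
  sSup {y | ∃ i < N.card ω, N.pt i ω ∈ D ∧ g (N.pt i ω) = y}

lemma finite_marks (N : PointProcess Ω X) (g : X → ℝ) (D : Set X) (ω : Ω) :
    {y | ∃ i < N.card ω, N.pt i ω ∈ D ∧ g (N.pt i ω) = y}.Finite := by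
  refine ((Set.finite_lt_nat (N.card ω)).image (fun i => g (N.pt i ω))).subset ?_
  rintro y ⟨i, hi, -, rfl⟩
  exact ⟨i, hi, rfl⟩

lemma count_eq_zero_iff (N : PointProcess Ω X) (D : Set X) (ω : Ω) :
    N.count D ω = 0 ↔ ∀ i < N.card ω, N.pt i ω ∉ D := by
  simp [PointProcess.count, Finset.filter_eq_empty_iff]

/-- The restriction to `w ≥ 0` comes from the value `0` of the supremum of an empty set of marks. -/
lemma maxMark_le_iff (N : PointProcess Ω X) {g : X → ℝ} {D : Set X} {w : ℝ} (hw : 0 ≤ w) (ω : Ω) :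
    maxMark N g D ω ≤ w ↔ ∀ i < N.card ω, N.pt i ω ∈ D → g (N.pt i ω) ≤ w := by
  constructor
  · intro h i hi hD
    exact (le_csSup (finite_marks N g D ω).bddAbove ⟨i, hi, hD, rfl⟩).trans h
  · intro h
    refine Real.sSup_le ?_ hw
    rintro y ⟨i, hi, hD, rfl⟩
    exact h i hi hD

lemma maxMark_nonneg (N : PointProcess Ω X) {g : X → ℝ} {D : Set X} (hg : ∀ x ∈ D, 0 ≤ g x)
    (ω : Ω) : 0 ≤ maxMark N g D ω := by
  refine Real.sSup_nonneg ?_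
  rintro y ⟨i, hi, hD, rfl⟩
  exact hg _ hD

lemma maxMark_eq_zero_of_count (N : PointProcess Ω X) (g : X → ℝ) {D : Set X} {ω : Ω}
    (h : N.count D ω = 0) : maxMark N g D ω = 0 := by
  rw [count_eq_zero_iff] at h
  have : {y | ∃ i < N.card ω, N.pt i ω ∈ D ∧ g (N.pt i ω) = y} = ∅ := by
    ext y
    simp only [Set.mem_ofPred_eq, Set.mem_empty_iff_false, iff_false]
    rintro ⟨i, hi, hD, -⟩
    exact h i hi hD
  rw [maxMark, this, Real.sSup_empty]

lemma measurable_count (N : PointProcess Ω X) {D : Set X} (hD : MeasurableSet D) :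
    Measurable (N.count D) := by
  classical
  have hF : ∀ n, Measurable fun ω => ∑ i ∈ Finset.range n, if N.pt i ω ∈ D then 1 else 0 := by
    intro n
    refine Finset.measurable_sum _ fun i _ => Measurable.ite (N.measurable_pt i hD) ?_ ?_ <;>
      exact measurable_const
  have : N.count D = fun ω => (fun n ω => ∑ i ∈ Finset.range n, if N.pt i ω ∈ D then 1 else 0)
      (N.card ω) ω := by
    funext ω
    simp only [PointProcess.count, Finset.card_filter]
  rw [this]
  -- The number of summands is random but takes countably many values, so measurability for each
  -- fixed number suffices.
  exact (measurable_from_prod_countable_right (f := fun q : ℕ × Ω =>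
    ∑ i ∈ Finset.range q.1, if N.pt i q.2 ∈ D then 1 else 0) hF).comp
    (N.measurable_card.prodMk measurable_id)

lemma count_eq_add (N : PointProcess Ω X) {A B D : Set X} (hAB : Disjoint A B) (h : A ∪ B = D)
    (ω : Ω) : N.count D ω = N.count A ω + N.count B ω := by
  classical
  simp only [PointProcess.count, Finset.card_filter, ← Finset.sum_add_distrib]
  refine Finset.sum_congr rfl fun i _ => ?_
  subst h
  by_cases hA : N.pt i ω ∈ A
  · have hB : N.pt i ω ∉ B := Set.disjoint_left.1 hAB hA
    simp [hA, hB]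
  · simp [hA]

/-- The part of `D` with marks at most `w`. -/
def lowerPart (g : X → ℝ) (D : Set X) (w : ℝ) : Set X := D ∩ {x | g x ≤ w}

/-- The part of `D` with marks larger than `w`. -/
def upperPart (g : X → ℝ) (D : Set X) (w : ℝ) : Set X := D ∩ {x | w < g x}

lemma disjoint_lowerPart_upperPart (g : X → ℝ) (D : Set X) (w : ℝ) :
    Disjoint (lowerPart g D w) (upperPart g D w) := by
  rw [Set.disjoint_left]
  rintro x ⟨-, h⟩ ⟨-, h'⟩
  simp only [Set.mem_ofPred_eq] at h h'
  exact absurd h (not_le.2 h')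

lemma lowerPart_union_upperPart (g : X → ℝ) (D : Set X) (w : ℝ) :
    lowerPart g D w ∪ upperPart g D w = D := by
  ext x
  simp only [lowerPart, upperPart, Set.mem_union, Set.mem_inter_iff, Set.mem_ofPred_eq]
  have := le_or_gt (g x) w
  tauto

lemma measurableSet_lowerPart {g : X → ℝ} (hg : Measurable g) {D : Set X} (hD : MeasurableSet D)
    (w : ℝ) : MeasurableSet (lowerPart g D w) :=
  hD.inter (measurableSet_le hg measurable_const)

lemma measurableSet_upperPart {g : X → ℝ} (hg : Measurable g) {D : Set X} (hD : MeasurableSet D)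
    (w : ℝ) : MeasurableSet (upperPart g D w) :=
  hD.inter (measurableSet_lt measurable_const hg)

lemma maxMark_le_iff_count (N : PointProcess Ω X) {g : X → ℝ} {D : Set X} {w : ℝ} (hw : 0 ≤ w)
    (ω : Ω) : maxMark N g D ω ≤ w ↔ N.count (upperPart g D w) ω = 0 := by
  rw [maxMark_le_iff N hw, count_eq_zero_iff]
  simp only [upperPart, Set.mem_inter_iff, Set.mem_ofPred_eq, not_and, not_lt]

/-- Events on maxima become events on counts: all marks are at most `w` exactly when the upper part
is empty, and then the lower part carries the whole count. The two parts are disjoint, so the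
Poisson axioms apply. -/
lemma count_eq_and_maxMark_le (N : PointProcess Ω X) {g : X → ℝ} {D : Set X} {w : ℝ} (hw : 0 ≤ w)
    (j : ℕ) : {ω | N.count D ω = j ∧ maxMark N g D ω ≤ w} =
      N.count (lowerPart g D w) ⁻¹' {j} ∩ N.count (upperPart g D w) ⁻¹' {0} := by
  ext ω
  simp only [Set.mem_ofPred_eq, Set.mem_inter_iff, Set.mem_preimage, Set.mem_singleton_iff,
    maxMark_le_iff_count N hw,
    count_eq_add N (disjoint_lowerPart_upperPart g D w) (lowerPart_union_upperPart g D w)]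
  omega

lemma measurable_maxMark (N : PointProcess Ω X) {g : X → ℝ} (hg : Measurable g) {D : Set X}
    (hD : MeasurableSet D) (h0 : ∀ x ∈ D, 0 ≤ g x) : Measurable (maxMark N g D) := by
  refine measurable_of_Iic fun w => ?_
  rcases le_or_gt 0 w with hw | hw
  · have : maxMark N g D ⁻¹' Set.Iic w = N.count (upperPart g D w) ⁻¹' {0} := by
      ext ω
      simp [maxMark_le_iff_count N hw]
    rw [this]
    exact measurable_count N (measurableSet_upperPart hg hD w) (measurableSet_singleton 0)
  · have : maxMark N g D ⁻¹' Set.Iic w = ∅ := by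
      ext ω
      simp only [Set.mem_preimage, Set.mem_Iic, Set.mem_empty_iff_false, iff_false, not_le]
      exact hw.trans_le (maxMark_nonneg N h0 ω)
    rw [this]
    exact MeasurableSet.empty

/-- The event that there are `j` points in `D`, with marks at most `w`. -/
def markEvents (N : PointProcess Ω X) (g : X → ℝ) (D : Set X) : Set (Set Ω) :=
  {s | ∃ (j : ℕ) (w : ℝ), 0 ≤ w ∧ s = {ω | N.count D ω = j ∧ maxMark N g D ω ≤ w}}

/-- Events with different `j` are disjoint, so a nonempty intersection forces equal counts, and the
bounds combine to their minimum. -/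
lemma isPiSystem_markEvents (N : PointProcess Ω X) (g : X → ℝ) (D : Set X) :
    IsPiSystem (markEvents N g D) := by
  rintro _ ⟨j, w, hw, rfl⟩ _ ⟨j', w', hw', rfl⟩ ⟨ω, h, h'⟩
  obtain rfl : j = j' := h.1.symm.trans h'.1
  refine ⟨j, min w w', le_min hw hw', ?_⟩
  ext ω
  simp only [Set.mem_inter_iff, Set.mem_ofPred_eq, le_min_iff]
  tauto

lemma measurable_markEvents_count (N : PointProcess Ω X) (g : X → ℝ) (D : Set X) :
    Measurable[MeasurableSpace.generateFrom (markEvents N g D)] (N.count D) := by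
  refine @measurable_to_countable' _ _ _ _ (MeasurableSpace.generateFrom (markEvents N g D)) _ ?_
  intro j
  have : N.count D ⁻¹' {j} = ⋃ m : ℕ, {ω | N.count D ω = j ∧ maxMark N g D ω ≤ m} := by
    ext ω
    simp only [Set.mem_preimage, Set.mem_singleton_iff, Set.mem_iUnion, Set.mem_ofPred_eq,
      exists_and_left, iff_self_and]
    exact fun _ => exists_nat_ge _
  rw [this]
  exact MeasurableSet.iUnion fun m =>
    MeasurableSpace.measurableSet_generateFrom ⟨j, m, Nat.cast_nonneg m, rfl⟩

lemma measurable_markEvents_maxMark (N : PointProcess Ω X) {g : X → ℝ} {D : Set X}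
    (h0 : ∀ x ∈ D, 0 ≤ g x) :
    Measurable[MeasurableSpace.generateFrom (markEvents N g D)] (maxMark N g D) := by
  refine @measurable_of_Iic _ _ _ _ _ (MeasurableSpace.generateFrom (markEvents N g D)) _ _ _ _ ?_
  intro w
  rcases le_or_gt 0 w with hw | hw
  · have : maxMark N g D ⁻¹' Set.Iic w =
        ⋃ j : ℕ, {ω | N.count D ω = j ∧ maxMark N g D ω ≤ w} := by
      ext ω
      simp
    rw [this]
    exact MeasurableSet.iUnion fun j =>
      MeasurableSpace.measurableSet_generateFrom ⟨j, w, hw, rfl⟩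
  · have : maxMark N g D ⁻¹' Set.Iic w = ∅ := by
      ext ω
      simp only [Set.mem_preimage, Set.mem_Iic, Set.mem_empty_iff_false, iff_false, not_le]
      exact hw.trans_le (maxMark_nonneg N h0 ω)
    rw [this]
    exact @MeasurableSet.empty _ (MeasurableSpace.generateFrom (markEvents N g D))

lemma generateFrom_markEvents_le (N : PointProcess Ω X) {g : X → ℝ} (hg : Measurable g) {D : Set X}
    (hD : MeasurableSet D) (h0 : ∀ x ∈ D, 0 ≤ g x) :
    MeasurableSpace.generateFrom (markEvents N g D) ≤ ‹MeasurableSpace Ω› := by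
  refine MeasurableSpace.generateFrom_le ?_
  rintro _ ⟨j, w, hw, rfl⟩
  exact (measurable_count N hD (measurableSet_singleton j)).inter
    (measurable_maxMark N hg hD h0 measurableSet_Iic)

end PointProcesses

/-! ### Independence and joint law of counts and maxima for a Poisson process -/

section Poisson

variable {Ω X : Type*} [MeasurableSpace Ω] [MeasurableSpace X] {P : Measure Ω}
  [IsProbabilityMeasure P] {N : PointProcess Ω X} {Λ : Measure X}

lemma PointProcess.IsPoisson.iIndepFun_of_fintype (hN : N.IsPoisson P Λ) {ι : Type*} [Fintype ι]
    (D : ι → Set X) (hD : ∀ i, MeasurableSet (D i)) (hdisj : Pairwise fun i j => Disjoint (D i) (D j)) :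
    iIndepFun (fun i => N.count (D i)) P := by
  let e := Fintype.equivFin ι
  have h := hN.iIndepFun_count (Fintype.card ι) (fun i => D (e.symm i)) (fun i => hD _)
    (fun i j hij => hdisj (e.symm.injective.ne hij))
  have h2 := h.precomp e.injective
  simpa using h2

/-- The numbers of points and the largest marks in disjoint sets are independent. -/
lemma PointProcess.IsPoisson.iIndep_markEvents (hN : N.IsPoisson P Λ) {ι : Type*} [Fintype ι]
    {g : X → ℝ} (hg : Measurable g) (D : ι → Set X) (hD : ∀ i, MeasurableSet (D i))
    (hdisj : Pairwise fun i j => Disjoint (D i) (D j)) (h0 : ∀ i, ∀ x ∈ D i, 0 ≤ g x) :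
    iIndep (fun i => MeasurableSpace.generateFrom (markEvents N g (D i))) P := by
  classical
  refine iIndepSets.iIndep (fun i => generateFrom_markEvents_le N hg (hD i) (h0 i))
    (fun i => markEvents N g (D i)) (fun i => isPiSystem_markEvents N g (D i)) (fun i => rfl) ?_
  rw [iIndepSets_iff]
  intro s E hE
  choose! j w hw hEq using hE
  -- Each set is cut at its own level `w i`; all the pieces are pairwise disjoint, so their counts
  -- are independent.
  set A : ι × Bool → Set X := fun q =>
    if q.2 then lowerPart g (D q.1) (w q.1) else upperPart g (D q.1) (w q.1) with hA
  have hAsub : ∀ q, A q ⊆ D q.1 := by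
    rintro ⟨i, b⟩
    cases b <;> simp [hA, lowerPart, upperPart]
  have hind := hN.iIndepFun_of_fintype A (by
      rintro ⟨i, b⟩
      cases b
      · simpa [hA] using measurableSet_upperPart hg (hD i) (w i)
      · simpa [hA] using measurableSet_lowerPart hg (hD i) (w i)) (by
      rintro ⟨i, b⟩ ⟨i', b'⟩ hne
      by_cases hi : i = i'
      · subst hi
        cases b <;> cases b'
        · exact absurd rfl hne
        · simpa [hA] using (disjoint_lowerPart_upperPart g (D i) (w i)).symm
        · simpa [hA] using disjoint_lowerPart_upperPart g (D i) (w i)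
        · exact absurd rfl hne
      · exact (hdisj hi).mono (hAsub (i, b)) (hAsub (i', b')))
  have key := iIndepFun_iff_measure_inter_preimage_eq_mul.1 hind
  have hmeas : ∀ (t : Finset (ι × Bool)), P (⋂ q ∈ t, N.count (A q) ⁻¹' {if q.2 then j q.1 else 0}) =
      ∏ q ∈ t, P (N.count (A q) ⁻¹' {if q.2 then j q.1 else 0}) := fun t =>
    key t (sets := fun q => {if q.2 then j q.1 else 0}) (fun q _ => measurableSet_singleton _)
  have hpair : ∀ i, (N.count (lowerPart g (D i) (w i)) ⁻¹' {j i} ∩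
      N.count (upperPart g (D i) (w i)) ⁻¹' {0}) =
      ⋂ q ∈ ({i} ×ˢ Finset.univ : Finset (ι × Bool)),
        N.count (A q) ⁻¹' {if q.2 then j q.1 else 0} := by
    intro i
    ext ω
    simp [hA]
  -- The product formula is used twice: here for the two pieces of one set, and below for all pieces
  -- together.
  have hE' : ∀ i ∈ s, P (E i) = P (N.count (A (i, true)) ⁻¹' {j i}) *
      P (N.count (A (i, false)) ⁻¹' {0}) := by
    intro i hi
    rw [hEq i hi, count_eq_and_maxMark_le N (hw i hi), hpair, hmeas, Finset.prod_product]
    simp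
  have hI : ⋂ i ∈ s, E i = ⋂ q ∈ (s ×ˢ Finset.univ : Finset (ι × Bool)),
      N.count (A q) ⁻¹' {if q.2 then j q.1 else 0} := by
    have : ⋂ i ∈ s, E i = ⋂ i ∈ s, (N.count (lowerPart g (D i) (w i)) ⁻¹' {j i} ∩
      N.count (upperPart g (D i) (w i)) ⁻¹' {0}) := by
      refine Set.iInter₂_congr fun i hi => ?_
      rw [hEq i hi, count_eq_and_maxMark_le N (hw i hi)]
    rw [this]
    ext ω
    simp [hA]
    exact ⟨fun h a => ⟨fun ha => (h a ha).2, fun ha => (h a ha).1⟩,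
      fun h a ha => ⟨(h a).2 ha, (h a).1 ha⟩⟩
  rw [hI, hmeas, Finset.prod_product, Finset.prod_congr rfl hE']
  simp

lemma PointProcess.IsPoisson.measureReal_count (hN : N.IsPoisson P Λ) {D : Set X}
    (hD : MeasurableSet D) (hfin : Λ D ≠ ⊤) (j : ℕ) :
    P.real (N.count D ⁻¹' {j}) = Real.exp (-Λ.real D) * Λ.real D ^ j / (Nat.factorial j) := by
  have h := hN.hasLaw_count D hD hfin
  rw [← map_measureReal_apply_of_aemeasurable h.aemeasurable (measurableSet_singleton j),
    h.map_eq, poissonMeasure_real_singleton]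
  rfl

/-- A Poisson variable of mean zero vanishes almost surely. This permits discarding locations where
an almost-everywhere bound on `f` fails. -/
lemma PointProcess.IsPoisson.ae_count_eq_zero (hN : N.IsPoisson P Λ) {D : Set X}
    (hD : MeasurableSet D) (h : Λ D = 0) : ∀ᵐ ω ∂P, N.count D ω = 0 := by
  have h1 := hN.measureReal_count hD (by simp [h]) 0
  have h2 : P.real (N.count D ⁻¹' {0}) = 1 := by
    rw [h1]
    simp [measureReal_def, h]
  rw [measureReal_def, ENNReal.toReal_eq_one_iff] at h2
  exact (prob_compl_eq_zero_iff (measurable_count N hD (measurableSet_singleton 0))).2 h2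

/-- The joint law of the number of points and the largest mark. -/
lemma PointProcess.IsPoisson.measureReal_count_eq_and_maxMark_le (hN : N.IsPoisson P Λ) {g : X → ℝ}
    (hg : Measurable g) {D : Set X} (hD : MeasurableSet D) (hfin : Λ D ≠ ⊤) {w : ℝ} (hw : 0 ≤ w)
    (j : ℕ) : P.real {ω | N.count D ω = j ∧ maxMark N g D ω ≤ w} =
      Real.exp (-Λ.real D) * Λ.real (lowerPart g D w) ^ j / (Nat.factorial j) := by
  have hL := measurableSet_lowerPart hg hD w
  have hU := measurableSet_upperPart hg hD w
  have hLf : Λ (lowerPart g D w) ≠ ⊤ := measure_ne_top_of_subset Set.inter_subset_left hfin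
  have hUf : Λ (upperPart g D w) ≠ ⊤ := measure_ne_top_of_subset Set.inter_subset_left hfin
  have hind := hN.iIndepFun_of_fintype
    (fun b : Bool => if b then lowerPart g D w else upperPart g D w)
    (by rintro (_ | _) <;> simp [hL, hU]) (by
      rintro (_ | _) (_ | _) hne
      · exact absurd rfl hne
      · simpa using (disjoint_lowerPart_upperPart g D w).symm
      · simpa using disjoint_lowerPart_upperPart g D w
      · exact absurd rfl hne)
  have h2 := (hind.indepFun (i := true) (j := false) (by decide)).measure_inter_preimage_eq_mul
    {j} {0} (measurableSet_singleton _) (measurableSet_singleton _)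
  simp only [if_true, Bool.false_eq_true, if_false] at h2
  -- The exponential factors of the two independent counts multiply to the one for `D`.
  have hadd : Λ.real D = Λ.real (lowerPart g D w) + Λ.real (upperPart g D w) := by
    rw [← measureReal_union (disjoint_lowerPart_upperPart g D w) hU hLf hUf,
      lowerPart_union_upperPart]
  rw [count_eq_and_maxMark_le N hw, measureReal_def, h2, ENNReal.toReal_mul, ← measureReal_def,
    ← measureReal_def, hN.measureReal_count hL hLf, hN.measureReal_count hU hUf, hadd, neg_add,
    Real.exp_add]
  simp
  ring

end Poisson

/-! ### Moments of the fluctuation in one cell -/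

section CellLaw

/-- The standardised fluctuation of the bias corrected maximum in a cell. -/
def fluctuation {Ω : Type*} (lam : ℝ) (N : Ω → ℕ) (W : Ω → ℝ) (ω : Ω) : ℝ :=
  lam * ((1 + 1 / (N ω : ℝ)) * W ω - 1)

/-- The σ-algebra `m` is left arbitrary so that it can be the one generated by `markEvents`, for
which independence is known. -/
lemma comap_fluctuation_le {Ω : Type*} {m : MeasurableSpace Ω} {N : Ω → ℕ} {W : Ω → ℝ}
    (hN : Measurable N) (hW : Measurable W) (lam : ℝ) :
    MeasurableSpace.comap (fluctuation lam N W) (borel ℝ) ≤ m := by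
  refine Measurable.comap_le ?_
  have h : Measurable fun ω => (N ω : ℝ) := measurable_from_nat.comp hN
  unfold fluctuation
  fun_prop

variable {Ω : Type*} [MeasurableSpace Ω] {P : Measure Ω} [IsProbabilityMeasure P]

/-- The weight of `j` under the Poisson law with mean `lam`. -/
def poissonWeight (lam : ℝ) (j : ℕ) : ℝ := Real.exp (-lam) * lam ^ j / j.factorial

lemma poissonWeight_nonneg {lam : ℝ} (h : 0 ≤ lam) (j : ℕ) : 0 ≤ poissonWeight lam j := by
  unfold poissonWeight; positivity

lemma hasSum_poissonWeight {lam : ℝ} (h : 0 ≤ lam) : HasSum (poissonWeight lam) 1 :=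
  hasSum_one_poissonMeasure ⟨lam, h⟩

lemma poissonWeight_succ (lam : ℝ) (j : ℕ) :
    poissonWeight lam (j + 1) * (j + 1) = lam * poissonWeight lam j := by
  unfold poissonWeight
  rw [Nat.factorial_succ, pow_succ]
  push_cast
  field_simp

lemma poissonWeight_zero (lam : ℝ) : poissonWeight lam 0 = Real.exp (-lam) := by
  simp [poissonWeight]

lemma hasSum_poissonWeight_add {lam : ℝ} (h : 0 ≤ lam) (m : ℕ) :
    HasSum (fun j => poissonWeight lam (j + m))
      (1 - ∑ i ∈ Finset.range m, poissonWeight lam i) :=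
  (hasSum_nat_add_iff' m).2 (hasSum_poissonWeight h)

/-- The joint law of the number of points and the largest relative height in a cell with mean
number of points `lam`. -/
structure IsCellPair (P : Measure Ω) (N : Ω → ℕ) (W : Ω → ℝ) (lam : ℝ) : Prop where
  measurable_fst : Measurable N
  measurable_snd : Measurable W
  nonneg : ∀ ω, 0 ≤ W ω
  le_one : ∀ ω, W ω ≤ 1
  eq_zero : ∀ ω, N ω = 0 → W ω = 0
  law : ∀ (j : ℕ) (w : ℝ), 0 ≤ w → w ≤ 1 →
    P.real {ω | N ω = j ∧ W ω ≤ w} = poissonWeight lam j * w ^ j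

variable {N : Ω → ℕ} {W : Ω → ℝ} {lam : ℝ}

lemma IsCellPair.measureReal_eq (h : IsCellPair P N W lam) (j : ℕ) :
    P.real {ω | N ω = j} = poissonWeight lam j := by
  have := h.law j 1 zero_le_one le_rfl
  simpa [h.le_one] using this

lemma IsCellPair.measurableSet_eq (h : IsCellPair P N W lam) (j : ℕ) :
    MeasurableSet {ω | N ω = j} := h.measurable_fst (measurableSet_singleton j)

lemma IsCellPair.measureReal_eq_and_lt (h : IsCellPair P N W lam) (j : ℕ) {w : ℝ} (h0 : 0 ≤ w)
    (h1 : w ≤ 1) : P.real {ω | N ω = j ∧ w < W ω} = poissonWeight lam j * (1 - w ^ j) := by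
  have hm : MeasurableSet {ω | W ω ≤ w} := h.measurable_snd measurableSet_Iic
  have h2 := measureReal_inter_add_sdiff (μ := P) (s := {ω | N ω = j}) hm
  rw [h.measureReal_eq] at h2
  have e1 : {ω | N ω = j} ∩ {ω | W ω ≤ w} = {ω | N ω = j ∧ W ω ≤ w} := by ext; simp
  have e2 : {ω | N ω = j} \ {ω | W ω ≤ w} = {ω | N ω = j ∧ w < W ω} := by ext; simp
  rw [e1, e2, h.law j _ h0 h1] at h2
  linarith

/-- Layer-cake formula: on `N = j` the tail of `W ^ p` at `t ∈ (0, 1]` is `poissonWeight lam j * (1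
- t ^ (j / p))`, and integrating `1 - t ^ (j / p)` over the unit interval gives `j / (j + p)`. -/
lemma IsCellPair.setIntegral_pow (h : IsCellPair P N W lam) {j p : ℕ} (hj : 1 ≤ j) (hp : 1 ≤ p) :
    ∫ ω in {ω | N ω = j}, W ω ^ p ∂P = poissonWeight lam j * (j / (j + p)) := by
  have hp0 : (0 : ℝ) < p := by exact_mod_cast hp
  have hj0 : (0 : ℝ) < j := by exact_mod_cast hj
  have hint : Integrable (fun ω => W ω ^ p) (P.restrict {ω | N ω = j}) := by
    refine Integrable.of_bound (h.measurable_snd.pow_const p).aestronglyMeasurable 1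
      (ae_of_all _ fun ω => ?_)
    rw [Real.norm_eq_abs, abs_of_nonneg (pow_nonneg (h.nonneg ω) p)]
    exact pow_le_one₀ (h.nonneg ω) (h.le_one ω)
  rw [hint.integral_eq_integral_meas_lt (ae_of_all _ fun ω => pow_nonneg (h.nonneg ω) p)]
  have hF : ∀ t ∈ Set.Ioi (0 : ℝ), (P.restrict {ω | N ω = j}).real {ω | t < W ω ^ p} =
      (Set.Ioc 0 1).indicator (fun t => poissonWeight lam j * (1 - t ^ ((j : ℝ) / p))) t := by
    intro t ht
    have ht0 : (0 : ℝ) < t := ht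
    rw [measureReal_restrict_apply (measurableSet_lt measurable_const (h.measurable_snd.pow_const p))]
    by_cases h1 : t ≤ 1
    · rw [Set.indicator_of_mem (Set.mem_Ioc.2 ⟨ht0, h1⟩)]
      have h3 : t ^ ((j : ℝ) / p) = (t ^ ((p : ℝ)⁻¹)) ^ j := by
        rw [← Real.rpow_natCast, ← Real.rpow_mul ht0.le]
        congr 1
        field_simp
      rw [h3, ← h.measureReal_eq_and_lt j (by positivity)
        (Real.rpow_le_one ht0.le h1 (by positivity))]
      congr 1
      ext ω
      simp only [Set.mem_inter_iff, Set.mem_ofPred_eq]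
      rw [and_comm, and_congr_right_iff]
      intro _
      rw [← Real.rpow_natCast, ← Real.rpow_inv_lt_iff_of_pos ht0.le (h.nonneg ω) hp0]
    · rw [Set.indicator_of_notMem (fun hh => h1 hh.2)]
      have : {ω | t < W ω ^ p} ∩ {ω | N ω = j} = ∅ := by
        ext ω
        simp only [Set.mem_inter_iff, Set.mem_ofPred_eq, Set.mem_empty_iff_false, iff_false,
          not_and]
        intro hlt
        exact absurd (hlt.trans_le (pow_le_one₀ (h.nonneg ω) (h.le_one ω))) (by linarith)
      rw [this, measureReal_empty]
  rw [setIntegral_congr_fun measurableSet_Ioi hF, setIntegral_indicator measurableSet_Ioc]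
  have : Set.Ioi (0 : ℝ) ∩ Set.Ioc 0 1 = Set.Ioc 0 1 := by
    ext; simp
  have hjp : (0 : ℝ) < j / p := by positivity
  rw [this, ← intervalIntegral.integral_of_le zero_le_one, intervalIntegral.integral_const_mul,
    intervalIntegral.integral_sub (by simp) (intervalIntegral.intervalIntegrable_rpow' (by linarith)),
    integral_rpow (Or.inl (by linarith))]
  simp only [intervalIntegral.integral_const, sub_zero, smul_eq_mul, mul_one, Real.one_rpow]
  rw [Real.zero_rpow (by positivity)]
  field_simp
  ring

lemma IsCellPair.measurable_fluctuation (h : IsCellPair P N W lam) :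
    Measurable (fluctuation lam N W) := by
  have h1 : Measurable fun ω => (N ω : ℝ) := measurable_from_nat.comp h.measurable_fst
  have h2 := h.measurable_snd
  unfold fluctuation
  fun_prop

/-- `(1 + 1/N) W` lies in `[0, 2]`, also for an empty cell, where `1 / 0 = 0` and `W = 0`. -/
lemma IsCellPair.abs_fluctuation_le (h : IsCellPair P N W lam) (hl : 0 ≤ lam) (ω : Ω) :
    |fluctuation lam N W ω| ≤ lam := by
  unfold fluctuation
  rw [abs_mul, abs_of_nonneg hl]
  refine mul_le_of_le_one_right hl ?_
  rcases Nat.eq_zero_or_pos (N ω) with h0 | h0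
  · simp [h.eq_zero ω h0]
  · have h1 : (1 : ℝ) ≤ N ω := by exact_mod_cast h0
    have h2 : 1 / (N ω : ℝ) ≤ 1 := by rw [div_le_one (by linarith)]; exact h1
    have h3 : 0 ≤ 1 / (N ω : ℝ) := by positivity
    have h4 := h.nonneg ω
    have h5 := h.le_one ω
    rw [abs_le]
    constructor <;> nlinarith

lemma IsCellPair.integrable_fluctuation_pow (h : IsCellPair P N W lam) (hl : 0 ≤ lam) (q : ℕ) :
    Integrable (fun ω => fluctuation lam N W ω ^ q) P := by
  refine Integrable.of_bound (h.measurable_fluctuation.pow_const q).aestronglyMeasurable (lam ^ q)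
    (ae_of_all _ fun ω => ?_)
  rw [Real.norm_eq_abs, abs_pow]
  exact pow_le_pow_left₀ (abs_nonneg _) (h.abs_fluctuation_le hl ω) q

/-- Decomposing over the values of the count reduces every moment to explicit integrals on `N = j`.
-/
lemma IsCellPair.hasSum_integral (h : IsCellPair P N W lam) (hl : 0 ≤ lam) (q : ℕ) :
    HasSum (fun j => ∫ ω in {ω | N ω = j}, fluctuation lam N W ω ^ q ∂P)
      (∫ ω, fluctuation lam N W ω ^ q ∂P) := by
  have hU : ⋃ j, {ω | N ω = j} = Set.univ := by ext; simp
  have := hasSum_integral_iUnion (μ := P) (f := fun ω => fluctuation lam N W ω ^ q)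
    (s := fun j => {ω | N ω = j}) (fun j => h.measurableSet_eq j)
    (fun i j hij => Set.disjoint_left.2 fun ω hi hj => hij (by
      simp only [Set.mem_ofPred_eq] at hi hj; omega))
    (h.integrable_fluctuation_pow hl q).integrableOn
  rwa [hU, setIntegral_univ] at this

lemma IsCellPair.setIntegral_zero (h : IsCellPair P N W lam) (q : ℕ) :
    ∫ ω in {ω | N ω = 0}, fluctuation lam N W ω ^ q ∂P = poissonWeight lam 0 * (-lam) ^ q := by
  have : ∀ ω ∈ {ω | N ω = 0}, fluctuation lam N W ω ^ q = (-lam) ^ q := by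
    intro ω hω
    simp [fluctuation, h.eq_zero ω hω]
  rw [setIntegral_congr_fun (h.measurableSet_eq 0) this, setIntegral_const, h.measureReal_eq,
    smul_eq_mul]

lemma IsCellPair.integrableOn_pow (h : IsCellPair P N W lam) (j p : ℕ) :
    IntegrableOn (fun ω => W ω ^ p) {ω | N ω = j} P := by
  refine Integrable.of_bound (h.measurable_snd.pow_const p).aestronglyMeasurable 1
    (ae_of_all _ fun ω => ?_)
  rw [Real.norm_eq_abs, abs_of_nonneg (pow_nonneg (h.nonneg ω) p)]
  exact pow_le_one₀ (h.nonneg ω) (h.le_one ω)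

lemma IsCellPair.setIntegral_pow' (h : IsCellPair P N W lam) {j : ℕ} (hj : 1 ≤ j) (p : ℕ) :
    ∫ ω in {ω | N ω = j}, W ω ^ p ∂P = poissonWeight lam j * (j / (j + p)) := by
  rcases Nat.eq_zero_or_pos p with rfl | hp
  · have hj0 : (j : ℝ) ≠ 0 := by positivity
    simp [h.measureReal_eq, hj0]
  · exact h.setIntegral_pow hj hp

lemma IsCellPair.setIntegral_succ (h : IsCellPair P N W lam) {j : ℕ} (hj : 1 ≤ j) (q : ℕ) :
    ∫ ω in {ω | N ω = j}, fluctuation lam N W ω ^ q ∂P =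
      poissonWeight lam j * lam ^ q * ∑ p ∈ Finset.range (q + 1),
        (1 + 1 / (j : ℝ)) ^ p * (j / (j + p)) * (-1) ^ (q - p) * q.choose p := by
  have : ∀ ω ∈ {ω | N ω = j}, fluctuation lam N W ω ^ q = ∑ p ∈ Finset.range (q + 1),
      lam ^ q * (1 + 1 / (j : ℝ)) ^ p * (-1) ^ (q - p) * q.choose p * W ω ^ p := by
    intro ω hω
    simp only [Set.mem_ofPred_eq] at hω
    rw [fluctuation, hω, mul_pow, sub_eq_add_neg, add_pow, Finset.mul_sum]
    refine Finset.sum_congr rfl fun p _ => ?_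
    rw [mul_pow]
    ring
  rw [setIntegral_congr_fun (h.measurableSet_eq j) this,
    integral_finsetSum _ fun p _ => (h.integrableOn_pow j p).const_mul _, Finset.mul_sum]
  refine Finset.sum_congr rfl fun p _ => ?_
  rw [integral_const_mul, h.setIntegral_pow' hj]
  ring

/-- For `N = j ≥ 1` the conditional mean `j / (j + 1)` of `W` is cancelled by the factor `1 + 1/j`.
Only the empty cell, where the fluctuation is `-lam`, contributes. -/
lemma IsCellPair.integral_fluctuation (h : IsCellPair P N W lam) (hl : 0 ≤ lam) :
    ∫ ω, fluctuation lam N W ω ∂P = -(lam * Real.exp (-lam)) := by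
  have h1 := h.hasSum_integral hl 1
  have h2 : ∀ j ≠ 0, ∫ ω in {ω | N ω = j}, fluctuation lam N W ω ^ 1 ∂P = 0 := by
    intro j hj
    have hj1 : 1 ≤ j := Nat.one_le_iff_ne_zero.2 hj
    have hj0 : (0 : ℝ) < j := by exact_mod_cast hj1
    rw [h.setIntegral_succ hj1]
    simp only [Finset.sum_range_succ, Finset.sum_range_zero]
    simp
    right
    field_simp
    ring
  have h3 := h1.unique (hasSum_single 0 h2)
  simp only [pow_one] at h3
  rw [h3]
  have := h.setIntegral_zero 1
  simp only [pow_one] at this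
  rw [this, poissonWeight_zero]
  ring

lemma IsCellPair.setIntegral_sq (h : IsCellPair P N W lam) {j : ℕ} (hj : 1 ≤ j) :
    ∫ ω in {ω | N ω = j}, fluctuation lam N W ω ^ 2 ∂P =
      poissonWeight lam j * lam ^ 2 / (j * (j + 2)) := by
  have hj0 : (0 : ℝ) < j := by exact_mod_cast hj
  rw [h.setIntegral_succ hj]
  simp only [Finset.sum_range_succ, Finset.sum_range_zero]
  norm_num
  field_simp
  ring

/-- Powers of `lam` are traded for index shifts, so that scaled moments become sums of shifted
Poisson weights, of total at most `1`. -/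
lemma poissonWeight_add_two (lam : ℝ) (j : ℕ) :
    poissonWeight lam j * lam ^ 2 = poissonWeight lam (j + 2) * ((j + 1) * (j + 2)) := by
  have h1 := poissonWeight_succ lam j
  have h2 := poissonWeight_succ lam (j + 1)
  push_cast at h2
  have : poissonWeight lam (j + 2) * ((j + 1) * (j + 2)) =
    (poissonWeight lam (j + 1 + 1) * (j + 1 + 1)) * (j + 1) := by ring_nf
  rw [this, h2]
  linear_combination (-lam) * h1

lemma poissonWeight_add_four (lam : ℝ) (j : ℕ) :
    poissonWeight lam j * lam ^ 4 =
      poissonWeight lam (j + 4) * ((j + 1) * (j + 2) * (j + 3) * (j + 4)) := by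
  have h1 := poissonWeight_add_two lam j
  have h2 := poissonWeight_add_two lam (j + 2)
  push_cast at h2
  have : poissonWeight lam (j + 4) * ((j + 1) * (j + 2) * (j + 3) * (j + 4)) =
    (poissonWeight lam (j + 2 + 2) * ((j + 2 + 1) * (j + 2 + 2))) * ((j + 1) * (j + 2)) := by ring_nf
  rw [this, ← h2]
  linear_combination lam ^ 2 * h1

/-- After a shift by two, the term of `j ≥ 1` is `poissonWeight lam (j + 2) * (j + 1) / j`, at least
the shifted weight. The shifted weights add up to `1 - e^{-lam} (1 + lam)`. -/
lemma IsCellPair.integral_fluctuation_sq_ge (h : IsCellPair P N W lam) (hl : 0 < lam) :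
    1 - 2 / lam ≤ ∫ ω, fluctuation lam N W ω ^ 2 ∂P := by
  have h1 := h.hasSum_integral hl.le 2
  have h2 := hasSum_poissonWeight_add hl.le 2
  have h3 := hasSum_le (fun j => ?_) h2 h1
  · refine le_trans ?_ h3
    simp only [Finset.sum_range_succ, Finset.sum_range_zero, poissonWeight]
    have h4 : lam * (1 + lam) ≤ 2 * Real.exp lam := by
      have := Real.quadratic_le_exp_of_nonneg hl.le
      nlinarith
    have h5 : Real.exp (-lam) * (1 + lam) ≤ 2 / lam := by
      rw [Real.exp_neg, le_div_iff₀ hl, mul_assoc, inv_mul_le_iff₀ (Real.exp_pos _)]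
      linarith
    simp
    linarith
  · have hp := poissonWeight_add_two lam j
    have hnn := poissonWeight_nonneg hl.le (j + 2)
    rcases Nat.eq_zero_or_pos j with rfl | hj
    · rw [h.setIntegral_zero]
      simp only [Nat.cast_zero, zero_add, one_mul] at hp
      rw [neg_sq, hp]
      simp only [zero_add] at hnn
      simp only [zero_add]
      linarith
    · have hj0 : (0 : ℝ) < j := by exact_mod_cast hj
      rw [h.setIntegral_sq hj, hp, le_div_iff₀ (by positivity)]
      refine mul_le_mul_of_nonneg_left ?_ hnn
      nlinarith

/-- The same term is at most `poissonWeight lam (j + 2) * (1 + 4 / (j + 3))`, because `1 / j ≤ 4 /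
(j + 3)` for `j ≥ 1`. Dividing by `j + 3` is one more index shift, at the price of `1 / lam`. -/
lemma IsCellPair.integral_fluctuation_sq_le (h : IsCellPair P N W lam) (hl : 0 < lam) :
    ∫ ω, fluctuation lam N W ω ^ 2 ∂P ≤ 1 + 4 / lam := by
  have h1 := h.hasSum_integral hl.le 2
  have h2 := (hasSum_poissonWeight_add hl.le 2).add
    ((hasSum_poissonWeight_add hl.le 3).mul_left (4 / lam))
  have h3 := hasSum_le (fun j => ?_) h1 h2
  · refine h3.trans ?_
    have hs : ∀ m, 0 ≤ ∑ i ∈ Finset.range m, poissonWeight lam i := fun m =>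
      Finset.sum_nonneg fun i _ => poissonWeight_nonneg hl.le i
    have h4 : 0 ≤ 4 / lam := by positivity
    nlinarith [hs 2, hs 3]
  · have hp := poissonWeight_add_two lam j
    have hnn := poissonWeight_nonneg hl.le (j + 2)
    have hs : poissonWeight lam (j + 3) = lam * poissonWeight lam (j + 2) / (j + 3) := by
      have := poissonWeight_succ lam (j + 2)
      push_cast at this
      rw [eq_div_iff (by positivity), ← this]
      ring_nf
    rw [hs]
    have he : poissonWeight lam (j + 2) + 4 / lam * (lam * poissonWeight lam (j + 2) / (j + 3)) =
        poissonWeight lam (j + 2) * (1 + 4 / (j + 3)) := by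
      field_simp
    rw [he]
    rcases Nat.eq_zero_or_pos j with rfl | hj
    · rw [h.setIntegral_zero]
      simp only [Nat.cast_zero, zero_add, one_mul] at hp
      rw [neg_sq, hp]
      simp only [zero_add] at hnn
      norm_num
      linarith
    · have hj0 : (1 : ℝ) ≤ j := by exact_mod_cast hj
      rw [h.setIntegral_sq hj, hp, mul_div_assoc]
      refine mul_le_mul_of_nonneg_left ?_ hnn
      rw [div_le_iff₀ (by positivity), one_add_div (by positivity), div_mul_eq_mul_div,
        le_div_iff₀ (by positivity)]
      nlinarith

/-- The left side is the conditional fourth moment of `(1 + 1/j) W - 1`; the binomial terms of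
degree `0` and `1` add up to `-3`. It equals `(9 j² - 3 j + 6) / (j³ (j + 2) (j + 3) (j + 4))`, so
`100` is generous. The denominator on the right cancels against `poissonWeight_add_four`. -/
lemma fourth_moment_aux {j : ℝ} (hj : 1 ≤ j) :
    (1 + 1 / j) ^ 4 * (j / (j + 4)) - 4 * ((1 + 1 / j) ^ 3 * (j / (j + 3))) +
      6 * ((1 + 1 / j) ^ 2 * (j / (j + 2))) - 3 ≤
      100 / ((j + 1) * (j + 2) * (j + 3) * (j + 4)) := by
  -- In terms of `m = j - 1 ≥ 0` the numerator of the difference has only positive coefficients.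
  obtain ⟨m, hm, rfl⟩ : ∃ m : ℝ, 0 ≤ m ∧ j = m + 1 := ⟨j - 1, by linarith, by ring⟩
  rw [← sub_nonneg]
  have : 100 / ((m + 1 + 1) * (m + 1 + 2) * (m + 1 + 3) * (m + 1 + 4)) -
      ((1 + 1 / (m + 1)) ^ 4 * ((m + 1) / (m + 1 + 4)) -
        4 * ((1 + 1 / (m + 1)) ^ 3 * ((m + 1) / (m + 1 + 3))) +
      6 * ((1 + 1 / (m + 1)) ^ 2 * ((m + 1) / (m + 1 + 2))) - 3) =
      (100 * (m + 1) ^ 3 - (m + 2) * (9 * (m + 1) ^ 2 - 3 * (m + 1) + 6)) /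
        ((m + 1) ^ 3 * (m + 2) * (m + 3) * (m + 4) * (m + 5)) := by
    field_simp
    ring
  rw [this]
  refine div_nonneg ?_ (by positivity)
  have h3 : 0 ≤ m ^ 3 := by positivity
  have h2 : 0 ≤ m ^ 2 := by positivity
  nlinarith

lemma IsCellPair.integral_fluctuation_pow_four_le (h : IsCellPair P N W lam) (hl : 0 < lam) :
    ∫ ω, fluctuation lam N W ω ^ 4 ∂P ≤ 100 := by
  have h1 := h.hasSum_integral hl.le 4
  have h2 := (hasSum_poissonWeight_add hl.le 4).mul_left 100
  have h3 := hasSum_le (fun j => ?_) h1 h2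
  · refine h3.trans ?_
    have hs : 0 ≤ ∑ i ∈ Finset.range 4, poissonWeight lam i :=
      Finset.sum_nonneg fun i _ => poissonWeight_nonneg hl.le i
    linarith
  · have hp := poissonWeight_add_four lam j
    have hnn := poissonWeight_nonneg hl.le (j + 4)
    rcases Nat.eq_zero_or_pos j with rfl | hj
    · rw [h.setIntegral_zero]
      simp only [Nat.cast_zero, zero_add, one_mul] at hp
      rw [Even.neg_pow (by decide), hp]
      simp only [zero_add] at hnn
      norm_num
      linarith
    · have hj0 : (1 : ℝ) ≤ j := by exact_mod_cast hj
      rw [h.setIntegral_succ hj, hp]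
      have := fourth_moment_aux hj0
      have e : ∑ p ∈ Finset.range (4 + 1),
          (1 + 1 / (j : ℝ)) ^ p * (j / (j + p)) * (-1) ^ (4 - p) * (Nat.choose 4 p) =
          (1 + 1 / (j : ℝ)) ^ 4 * (j / (j + 4)) - 4 * ((1 + 1 / (j : ℝ)) ^ 3 * (j / (j + 3))) +
      6 * ((1 + 1 / (j : ℝ)) ^ 2 * (j / (j + 2))) - 3 := by
        simp only [Finset.sum_range_succ, Finset.sum_range_zero]
        norm_num [Nat.choose]
        field_simp
        ring
      rw [e]
      calc _ ≤ poissonWeight lam (j + 4) * ((j + 1) * (j + 2) * (j + 3) * (j + 4)) *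
            (100 / ((j + 1) * (j + 2) * (j + 3) * (j + 4))) := by gcongr
        _ = _ := by field_simp

end CellLaw

/-! ### Quantitative comparison of characteristic functions -/

section CharacteristicFunctions

-- The constant is crude so that one cubic bound covers all real `y`: Taylor's remainder for `|y| ≤
-- 1`, and the triangle inequality otherwise, every term then being at most `|y| ^ 3`.
open Complex in
lemma norm_exp_mul_I_sub_quadratic_le (y : ℝ) :
    ‖exp (y * I) - (1 + y * I - y ^ 2 / 2)‖ ≤ 4 * |y| ^ 3 := by
  have hy : ‖(y * I : ℂ)‖ = |y| := by simp
  rcases le_or_gt |y| 1 with h | h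
  · have := exp_bound (x := y * I) (by rw [hy]; exact h) (n := 3) (by norm_num)
    rw [hy] at this
    have e : ∑ m ∈ Finset.range 3, (y * I : ℂ) ^ m / (m.factorial : ℂ) =
        1 + y * I - y ^ 2 / 2 := by
      simp [Finset.sum_range_succ, Nat.factorial, mul_pow]
      ring
    rw [e] at this
    refine this.trans ?_
    rw [mul_comm]
    refine mul_le_mul_of_nonneg_right ?_ (by positivity)
    norm_num [Nat.factorial]
  · have h1 : ‖exp (y * I)‖ = 1 := norm_exp_ofReal_mul_I y
    have h2 : ‖(1 + y * I - y ^ 2 / 2 : ℂ)‖ ≤ 1 + |y| + |y| ^ 2 / 2 := by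
      refine (norm_sub_le _ _).trans (add_le_add ((norm_add_le _ _).trans ?_) ?_)
      · simp
      · simp
    refine (norm_sub_le _ _).trans ?_
    rw [h1]
    have h3 : |y| ≤ |y| ^ 3 := le_self_pow₀ h.le (by norm_num)
    have h4 : |y| ^ 2 ≤ |y| ^ 3 := pow_le_pow_right₀ h.le (by norm_num)
    linarith

/-- Factors are exchanged one at a time, all the others having norm at most one. -/
lemma norm_prod_sub_prod_le_sum {ι : Type*} (s : Finset ι) (z w : ι → ℂ) (hz : ∀ i ∈ s, ‖z i‖ ≤ 1)
    (hw : ∀ i ∈ s, ‖w i‖ ≤ 1) : ‖∏ i ∈ s, z i - ∏ i ∈ s, w i‖ ≤ ∑ i ∈ s, ‖z i - w i‖ := by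
  classical
  induction s using Finset.induction_on with
  | empty => simp
  | insert a s ha ih =>
    rw [Finset.prod_insert ha, Finset.prod_insert ha, Finset.sum_insert ha]
    have hz' : ‖∏ i ∈ s, z i‖ ≤ 1 := by
      rw [norm_prod]
      exact Finset.prod_le_one (fun _ _ => norm_nonneg _) fun i hi =>
        hz i (Finset.mem_insert_of_mem hi)
    have e : z a * ∏ i ∈ s, z i - w a * ∏ i ∈ s, w i =
        (z a - w a) * ∏ i ∈ s, z i + w a * (∏ i ∈ s, z i - ∏ i ∈ s, w i) := by ring
    rw [e]
    refine (norm_add_le _ _).trans (add_le_add ?_ ?_)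
    · rw [norm_mul]
      exact mul_le_of_le_one_right (norm_nonneg _) hz'
    · rw [norm_mul]
      refine (mul_le_of_le_one_left (norm_nonneg _) (hw a (Finset.mem_insert_self _ _))).trans ?_
      exact ih (fun i hi => hz i (Finset.mem_insert_of_mem hi))
        fun i hi => hw i (Finset.mem_insert_of_mem hi)

variable {Ω : Type*} [MeasurableSpace Ω] {P : Measure Ω} [IsProbabilityMeasure P]

-- Integrating the quadratic expansion of `exp (i b X)`, the mean costs `η |b|`, the second moment
-- `δ b² / 2`, the remainder `4 M |b|³`, and replacing `1 - b² / 2` by `exp (-b² / 2)` at most `(b²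
-- / 2)²`. All but the first carry a factor `b²`, which stays summable over the cells.
open Complex in
lemma norm_integral_exp_sub_le {X : Ω → ℝ} {B η δ M b : ℝ} (hX : Measurable X)
    (hB : ∀ ω, |X ω| ≤ B) (h1 : |∫ ω, X ω ∂P| ≤ η) (h2 : |∫ ω, X ω ^ 2 ∂P - 1| ≤ δ)
    (h3 : ∫ ω, |X ω| ^ 3 ∂P ≤ M) (hb : |b| ≤ 1) :
    ‖∫ ω, exp ((b * X ω : ℝ) * I) ∂P - (Real.exp (-(b ^ 2 / 2)) : ℝ)‖ ≤
      η * |b| + (δ + 4 * M * |b| + b ^ 2) * b ^ 2 := by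
  have hintp : ∀ q : ℕ, Integrable (fun ω => |X ω| ^ q) P := fun q => by
    refine Integrable.of_bound (by fun_prop) (B ^ q) (ae_of_all _ fun ω => ?_)
    rw [Real.norm_eq_abs, abs_pow, abs_abs]
    exact pow_le_pow_left₀ (abs_nonneg _) (hB ω) q
  have hi1 : Integrable X P := by
    refine Integrable.of_bound (by fun_prop) B (ae_of_all _ hB)
  have hi2 : Integrable (fun ω => X ω ^ 2) P := by simpa using hintp 2
  have hexp : Integrable (fun ω => exp ((b * X ω : ℝ) * I)) P := by
    refine Integrable.of_bound (by fun_prop) 1 (ae_of_all _ fun ω => ?_)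
    rw [norm_exp_ofReal_mul_I]
  have hq : Integrable (fun ω => (1 + (b * X ω : ℝ) * I - (b * X ω : ℝ) ^ 2 / 2 : ℂ)) P := by
    have ha : Integrable (fun ω => ((b * X ω : ℝ) : ℂ) * I) P :=
      (hi1.const_mul b).ofReal.mul_const I
    have hc : Integrable (fun ω => ((b * X ω : ℝ) : ℂ) ^ 2 / 2) P := by
      have := ((hi2.const_mul (b ^ 2 / 2)).ofReal (𝕜 := ℂ))
      refine this.congr (ae_of_all _ fun ω => ?_)
      simp
      ring
    exact ((integrable_const _).add ha).sub hc
  have hqv : ∫ ω, (1 + (b * X ω : ℝ) * I - (b * X ω : ℝ) ^ 2 / 2 : ℂ) ∂P =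
      1 + (b * ∫ ω, X ω ∂P : ℝ) * I - ((b ^ 2 / 2) * ∫ ω, X ω ^ 2 ∂P : ℝ) := by
    have ha : Integrable (fun ω => ((b * X ω : ℝ) : ℂ) * I) P :=
      (hi1.const_mul b).ofReal.mul_const I
    have hc' : (fun ω => (((b ^ 2 / 2) * X ω ^ 2 : ℝ) : ℂ)) =
      fun ω => ((b * X ω : ℝ) : ℂ) ^ 2 / 2 := by
      funext ω; push_cast; ring
    have hc : Integrable (fun ω => ((b * X ω : ℝ) : ℂ) ^ 2 / 2) P := by
      rw [← hc']
      exact ((hi2.const_mul (b ^ 2 / 2)).ofReal (𝕜 := ℂ))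
    have hs : Integrable (fun ω => (1 + ((b * X ω : ℝ) : ℂ) * I)) P := (integrable_const _).add ha
    rw [integral_sub hs hc, integral_add (integrable_const _) ha,
      integral_mul_const, integral_complex_ofReal, integral_const_mul, ← hc',
      integral_complex_ofReal,
      integral_const_mul]
    simp
  have hA : ‖∫ ω, exp ((b * X ω : ℝ) * I) ∂P -
      (1 + (b * ∫ ω, X ω ∂P : ℝ) * I - ((b ^ 2 / 2) * ∫ ω, X ω ^ 2 ∂P : ℝ))‖ ≤
      4 * M * |b| ^ 3 := by
    rw [← hqv, ← integral_sub hexp hq]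
    refine (norm_integral_le_integral_norm _).trans ?_
    calc _ ≤ ∫ ω, 4 * |b| ^ 3 * |X ω| ^ 3 ∂P := by
          refine integral_mono (hexp.sub hq).norm ((hintp 3).const_mul _) fun ω => ?_
          refine (norm_exp_mul_I_sub_quadratic_le (b * X ω)).trans_eq ?_
          rw [abs_mul, mul_pow]
          ring
      _ ≤ 4 * |b| ^ 3 * M := by
          rw [integral_const_mul]
          gcongr
      _ = _ := by ring
  have hbb : b ^ 2 ≤ 1 := by
    rw [← sq_abs]; exact pow_le_one₀ (abs_nonneg _) hb
  have hC : |Real.exp (-(b ^ 2 / 2)) - 1 - -(b ^ 2 / 2)| ≤ (b ^ 2 / 2) ^ 2 := by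
    have := Real.norm_exp_sub_one_sub_id_le (x := -(b ^ 2 / 2)) (by
      rw [Real.norm_eq_abs, abs_neg, abs_of_nonneg (by positivity)]; linarith)
    simpa using this
  have hD : ‖(1 + (b * ∫ ω, X ω ∂P : ℝ) * I - ((b ^ 2 / 2) * ∫ ω, X ω ^ 2 ∂P : ℝ) : ℂ) -
      (Real.exp (-(b ^ 2 / 2)) : ℝ)‖ ≤ |b| * η + b ^ 2 / 2 * δ + (b ^ 2 / 2) ^ 2 := by
    have e : (1 + (b * ∫ ω, X ω ∂P : ℝ) * I - ((b ^ 2 / 2) * ∫ ω, X ω ^ 2 ∂P : ℝ) : ℂ) -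
      (Real.exp (-(b ^ 2 / 2)) : ℝ) = (b * ∫ ω, X ω ∂P : ℝ) * I -
        (((b ^ 2 / 2) * (∫ ω, X ω ^ 2 ∂P - 1) : ℝ) : ℂ) -
        ((Real.exp (-(b ^ 2 / 2)) - 1 - -(b ^ 2 / 2) : ℝ) : ℂ) := by
      push_cast; ring
    rw [e]
    refine (norm_sub_le _ _).trans (add_le_add ((norm_sub_le _ _).trans (add_le_add ?_ ?_)) ?_)
    · rw [norm_mul, norm_I, mul_one, norm_real, Real.norm_eq_abs, abs_mul]
      gcongr
    · rw [norm_real, Real.norm_eq_abs, abs_mul, abs_of_nonneg (by positivity : 0 ≤ b ^ 2 / 2)]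
      gcongr
    · rw [norm_real]
      exact hC
  have hδ : 0 ≤ δ := (abs_nonneg _).trans h2
  have e3 : |b| ^ 3 = |b| * b ^ 2 := by rw [pow_succ, sq_abs, mul_comm]
  rw [e3] at hA
  have := (norm_sub_le_norm_sub_add_norm_sub (∫ ω, exp ((b * X ω : ℝ) * I) ∂P)
    (1 + (b * ∫ ω, X ω ∂P : ℝ) * I - ((b ^ 2 / 2) * ∫ ω, X ω ^ 2 ∂P : ℝ) : ℂ)
    ((Real.exp (-(b ^ 2 / 2)) : ℝ) : ℂ)).trans (add_le_add hA hD)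
  refine this.trans ?_
  have : 0 ≤ b ^ 2 := sq_nonneg b
  nlinarith [mul_nonneg this hδ]

open Complex in
/-- A quantitative central limit theorem for weighted sums of independent variables. -/
lemma norm_integral_exp_sum_sub_le {ι : Type*} [Fintype ι] {X : ι → Ω → ℝ} {B η δ M β : ℝ}
    (hX : ∀ r, Measurable (X r)) (hind : iIndepFun X P) (hB : ∀ r ω, |X r ω| ≤ B)
    (h1 : ∀ r, |∫ ω, X r ω ∂P| ≤ η) (h2 : ∀ r, |∫ ω, X r ω ^ 2 ∂P - 1| ≤ δ)
    (h3 : ∀ r, ∫ ω, |X r ω| ^ 3 ∂P ≤ M) (hM : 0 ≤ M) (b : ι → ℝ) (hb : ∀ r, |b r| ≤ β)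
    (hβ : β ≤ 1) :
    ‖∫ ω, exp ((∑ r, b r * X r ω : ℝ) * I) ∂P - (Real.exp (-((∑ r, b r ^ 2) / 2)) : ℝ)‖ ≤
      η * ∑ r, |b r| + (δ + 4 * M * β + β ^ 2) * ∑ r, b r ^ 2 := by
  have e1 : ∫ ω, exp ((∑ r, b r * X r ω : ℝ) * I) ∂P =
      ∏ r, ∫ ω, exp ((b r * X r ω : ℝ) * I) ∂P := by
    have hc : iIndepFun (fun r ω => exp ((b r * X r ω : ℝ) * I)) P :=
      hind.comp (fun r x => exp ((b r * x : ℝ) * I)) fun r => by fun_prop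
    rw [← hc.integral_fun_prod_eq_prod_integral fun r => by fun_prop]
    congr 1
    funext ω
    rw [← exp_sum]
    congr 1
    push_cast
    rw [Finset.sum_mul]
  have e2 : ((Real.exp (-((∑ r, b r ^ 2) / 2)) : ℝ) : ℂ) =
      ∏ r, ((Real.exp (-(b r ^ 2 / 2)) : ℝ) : ℂ) := by
    rw [← ofReal_prod, ← Real.exp_sum, Finset.sum_neg_distrib, Finset.sum_div]
  rw [e1, e2]
  refine (norm_prod_sub_prod_le_sum _ _ _ (fun r _ => ?_) (fun r _ => ?_)).trans ?_
  · refine (norm_integral_le_integral_norm _).trans ?_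
    simp_rw [norm_exp_ofReal_mul_I]
    simp
  · rw [norm_real, Real.norm_eq_abs, Real.abs_exp, Real.exp_le_one_iff]
    have := sq_nonneg (b r)
    linarith
  · rw [Finset.mul_sum, Finset.mul_sum, ← Finset.sum_add_distrib]
    refine Finset.sum_le_sum fun r _ => ?_
    refine (norm_integral_exp_sub_le (hX r) (hB r) (h1 r) (h2 r) (h3 r)
      ((hb r).trans hβ)).trans ?_
    have h0 := abs_nonneg (b r)
    have hsq : b r ^ 2 ≤ β ^ 2 := by
      rw [← sq_abs]; exact pow_le_pow_left₀ h0 (hb r) 2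
    gcongr
    exact hb r

end CharacteristicFunctions

/-! ### Slutsky's theorem for variables on varying probability spaces -/

section Slutsky

variable {Ω : ℕ → Type*} [∀ n, MeasurableSpace (Ω n)] {P : (n : ℕ) → Measure (Ω n)}
  [∀ n, IsProbabilityMeasure (P n)]
  {Ω' : Type*} [MeasurableSpace Ω'] {P' : Measure Ω'} [IsProbabilityMeasure P']
  {G : Type*} [NormedAddCommGroup G] [SecondCountableTopology G] [MeasurableSpace G] [BorelSpace G]

/-- Convergence in distribution depends on the laws only, so the variables can be moved to one
product space, where convergence in measure makes sense. -/
lemma tendstoInDistribution_infinitePi_iff {X : (n : ℕ) → Ω n → G} {Z : Ω' → G}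
    (hX : ∀ n, AEMeasurable (X n) (P n)) :
    TendstoInDistribution (fun n (ω : (m : ℕ) → Ω m) => X n (ω n)) atTop Z
      (fun _ => Measure.infinitePi P) P' ↔ TendstoInDistribution X atTop Z P P' := by
  have hmp := fun n => measurePreserving_eval_infinitePi P n
  have hmap : ∀ n, (Measure.infinitePi P).map (fun ω => X n (ω n)) = (P n).map (X n) := by
    intro n
    have h := AEMeasurable.map_map_of_aemeasurable (g := X n) (f := Function.eval n)
      (μ := Measure.infinitePi P) (by rw [(hmp n).map_eq]; exact hX n)
      (hmp n).measurable.aemeasurable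
    rw [(hmp n).map_eq] at h
    exact h.symm
  have hX' : ∀ n, AEMeasurable (fun ω : (m : ℕ) → Ω m => X n (ω n)) (Measure.infinitePi P) :=
    fun n => (hX n).comp_quasiMeasurePreserving (hmp n).quasiMeasurePreserving
  constructor
  · intro h
    exact ⟨hX, h.aemeasurable_limit, h.tendsto.congr fun n => Subtype.ext (hmap n)⟩
  · intro h
    exact ⟨hX', h.aemeasurable_limit, h.tendsto.congr fun n => Subtype.ext (hmap n).symm⟩

lemma infinitePi_setOf_eval_mem {s : (n : ℕ) → Set (Ω n)} (n : ℕ) (hs : MeasurableSet (s n)) :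
    Measure.infinitePi P {ω | ω n ∈ s n} = P n (s n) :=
  (measurePreserving_eval_infinitePi P n).measure_preimage hs.nullMeasurableSet

/-- A perturbation that is bounded by a null sequence does not change the limit law. -/
lemma TendstoInDistribution.of_dist_le {X Y : (n : ℕ) → Ω n → G} {Z : Ω' → G}
    (h : TendstoInDistribution X atTop Z P P') (hY : ∀ n, AEMeasurable (Y n) (P n))
    {ε : ℕ → ℝ} (hε : Tendsto ε atTop (𝓝 0))
    (hXY : ∀ᶠ n in atTop, ∀ᵐ ω ∂P n, ‖Y n ω - X n ω‖ ≤ ε n) :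
    TendstoInDistribution Y atTop Z P P' := by
  have hX := h.forall_aemeasurable
  have hmp := fun n => measurePreserving_eval_infinitePi P n
  rw [← tendstoInDistribution_infinitePi_iff hX] at h
  rw [← tendstoInDistribution_infinitePi_iff hY]
  refine tendstoInDistribution_of_tendstoInMeasure_sub _ _ h ?_
    fun n => (hY n).comp_quasiMeasurePreserving (hmp n).quasiMeasurePreserving
  rw [tendstoInMeasure_iff_norm]
  intro e he
  -- Once `ε n < e`, the event of a deviation of at least `e` is null, so the probabilities are
  -- eventually equal to zero.
  refine tendsto_const_nhds.congr' ?_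
  filter_upwards [hXY, hε.eventually_lt_const he] with n h1 h2
  symm
  have h3 := (hmp n).quasiMeasurePreserving.ae h1
  rw [← nonpos_iff_eq_zero]
  refine (measure_mono_null ?_ h3).le
  intro ω hω hle
  simp only [Pi.sub_apply, Pi.zero_apply, sub_zero, Set.mem_ofPred_eq] at hω
  exact absurd (hω.trans hle) (not_le.2 h2)

/-- Multiplication with a factor that tends to `1` in probability does not change the limit law. -/
lemma TendstoInDistribution.smul_of_tendsto_one [NormedSpace ℝ G] {X : (n : ℕ) → Ω n → G}
    {Z : Ω' → G} (h : TendstoInDistribution X atTop Z P P') {Y : (n : ℕ) → Ω n → ℝ}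
    (hY : ∀ n, Measurable (Y n))
    (hY1 : ∀ e > 0, Tendsto (fun n => P n {ω | e ≤ |Y n ω - 1|}) atTop (𝓝 0)) :
    TendstoInDistribution (fun n ω => Y n ω • X n ω) atTop Z P P' := by
  have hX := h.forall_aemeasurable
  have hmp := fun n => measurePreserving_eval_infinitePi P n
  rw [← tendstoInDistribution_infinitePi_iff hX] at h
  rw [← tendstoInDistribution_infinitePi_iff (X := fun n ω => Y n ω • X n ω)
    fun n => (hY n).aemeasurable.smul (hX n)]
  have h1 : TendstoInMeasure (Measure.infinitePi P) (fun n (ω : (m : ℕ) → Ω m) => Y n (ω n)) atTop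
      (fun _ => (1 : ℝ)) := by
    rw [tendstoInMeasure_iff_norm]
    intro e he
    refine (hY1 e he).congr fun n => ?_
    exact (infinitePi_setOf_eval_mem (s := fun n => {ω | e ≤ |Y n ω - 1|}) n
      (measurableSet_le measurable_const ((hY n).sub_const 1).abs)).symm
  have := h.continuous_comp_prodMk_of_tendstoInMeasure_const
    (g := fun q : G × ℝ => q.2 • q.1) (by fun_prop) h1
    fun n => ((hY n).comp (measurable_pi_apply n)).aemeasurable
  simpa using this

end Slutsky

/-! ### The Poisson process above a cell, in relative heights -/

section Hypographs

variable {E : Type*} [MeasurableSpace E] {ν : Measure E} [IsProbabilityMeasure ν] {f : E → ℝ}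

/-- The height of a point relative to the boundary function. -/
def relHeight (f : E → ℝ) (q : E × ℝ) : ℝ := q.2 / f q.1

lemma measurable_relHeight (hf : Measurable f) : Measurable (relHeight f) :=
  measurable_snd.div (hf.comp measurable_fst)

lemma measurableSet_hypograph (hf : Measurable f) {A : Set E} (hA : MeasurableSet A) :
    MeasurableSet (hypograph f A) := by
  have h1 : MeasurableSet {q : E × ℝ | q.1 ∈ A} := measurable_fst hA
  have h2 : MeasurableSet {q : E × ℝ | 0 ≤ q.2} := measurableSet_le measurable_const measurable_snd
  have h3 : MeasurableSet {q : E × ℝ | q.2 ≤ f q.1} :=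
    measurableSet_le measurable_snd (hf.comp measurable_fst)
  exact h1.inter (h2.inter h3)

lemma disjoint_hypograph {A B : Set E} (h : Disjoint A B) :
    Disjoint (hypograph f A) (hypograph f B) :=
  Set.disjoint_left.2 fun _ hA hB => Set.disjoint_left.1 h hA.1 hB.1

lemma relHeight_nonneg (hf0 : ∀ x, 0 ≤ f x) {A : Set E} :
    ∀ q ∈ hypograph f A, 0 ≤ relHeight f q :=
  fun q hq => div_nonneg hq.2.1 (hf0 q.1)

lemma relHeight_le_one (hf0 : ∀ x, 0 ≤ f x) {A : Set E} {q : E × ℝ} (hq : q ∈ hypograph f A) :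
    relHeight f q ≤ 1 :=
  div_le_one_of_le₀ hq.2.2 (hf0 q.1)

/-- `w ≤ 1` keeps the scaled region inside the hypograph, and where `f` vanishes only height `0`
remains on both sides. Mass therefore scales by `w`: relative heights are uniform. -/
lemma lowerPart_relHeight (hf0 : ∀ x, 0 ≤ f x) (A : Set E) {w : ℝ} (h0 : 0 ≤ w) (h1 : w ≤ 1) :
    lowerPart (relHeight f) (hypograph f A) w = hypograph (fun x => w * f x) A := by
  ext q
  simp only [lowerPart, hypograph, relHeight, Set.mem_inter_iff, Set.mem_ofPred_eq]
  rcases (hf0 q.1).eq_or_lt with hx | hx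
  · rw [← hx]
    simp only [div_zero, mul_zero]
    tauto
  · rw [div_le_iff₀ hx]
    constructor
    · tauto
    · rintro ⟨ha, hb, hc⟩
      exact ⟨⟨ha, hb, hc.trans (mul_le_of_le_one_left hx.le h1)⟩, hc⟩

lemma prod_volume_hypograph (hf : Measurable f) (hf0 : ∀ x, 0 ≤ f x) (hfi : Integrable f ν)
    {A : Set E} (hA : MeasurableSet A) :
    (ν.prod volume) (hypograph f A) = ENNReal.ofReal (∫ x in A, f x ∂ν) := by
  rw [Measure.prod_apply (measurableSet_hypograph hf hA),
    ofReal_integral_eq_lintegral_ofReal hfi.integrableOn (ae_of_all _ hf0),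
    ← lintegral_indicator hA]
  congr 1
  funext x
  by_cases hx : x ∈ A
  · have : Prod.mk x ⁻¹' hypograph f A = Set.Icc 0 (f x) := by
      ext y; simp [hypograph, hx]
    rw [this, Real.volume_Icc, sub_zero, Set.indicator_of_mem hx]
  · have : Prod.mk x ⁻¹' hypograph f A = ∅ := by
      ext y; simp [hypograph, hx]
    rw [this, measure_empty, Set.indicator_of_notMem hx]

lemma intensity_hypograph (hf : Measurable f) (hf0 : ∀ x, 0 ≤ f x) (hfi : Integrable f ν)
    {b : ℝ} {A : Set E} (hA : MeasurableSet A) {w : ℝ} (hw0 : 0 ≤ w) (hw1 : w ≤ 1) :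
    intensity ν f b (hypograph (fun x => w * f x) A) =
      ENNReal.ofReal b * ENNReal.ofReal (w * ∫ x in A, f x ∂ν) := by
  have hsub : hypograph (fun x => w * f x) A ⊆ hypograph f Set.univ := fun q hq =>
    ⟨Set.mem_univ _, hq.2.1, hq.2.2.trans (mul_le_of_le_one_left (hf0 q.1) hw1)⟩
  rw [intensity, Measure.smul_apply, Measure.restrict_apply
    (measurableSet_hypograph (hf.const_mul w) hA), Set.inter_eq_left.2 hsub,
    prod_volume_hypograph (hf.const_mul w) (fun x => mul_nonneg hw0 (hf0 x)) (hfi.const_mul w) hA,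
    integral_const_mul, smul_eq_mul]

lemma intensity_real_hypograph (hf : Measurable f) (hf0 : ∀ x, 0 ≤ f x) (hfi : Integrable f ν)
    {b : ℝ} (hb : 0 ≤ b) {A : Set E} (hA : MeasurableSet A) {w : ℝ} (hw0 : 0 ≤ w) (hw1 : w ≤ 1) :
    (intensity ν f b).real (hypograph (fun x => w * f x) A) = b * (w * ∫ x in A, f x ∂ν) := by
  rw [measureReal_def, intensity_hypograph hf hf0 hfi hA hw0 hw1, ENNReal.toReal_mul,
    ENNReal.toReal_ofReal hb, ENNReal.toReal_ofReal]
  exact mul_nonneg hw0 (integral_nonneg hf0)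

lemma intensity_hypograph_ne_top (hf : Measurable f) (hf0 : ∀ x, 0 ≤ f x) (hfi : Integrable f ν)
    {b : ℝ} {A : Set E} (hA : MeasurableSet A) : intensity ν f b (hypograph f A) ≠ ⊤ := by
  have := intensity_hypograph hf hf0 hfi (b := b) hA zero_le_one le_rfl
  simp only [one_mul] at this
  rw [this]
  exact ENNReal.mul_ne_top ENNReal.ofReal_ne_top ENNReal.ofReal_ne_top

lemma intensity_eq_zero {b : ℝ} {B : Set E} (hB : ν B = 0) :
    intensity ν f b (B ×ˢ Set.univ) = 0 := by
  rw [intensity, Measure.smul_apply]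
  have h : (ν.prod volume).restrict (hypograph f Set.univ) (B ×ˢ (Set.univ : Set ℝ)) = 0 :=
    nonpos_iff_eq_zero.1 ((Measure.restrict_apply_le _ _).trans (by
      rw [Measure.prod_prod, hB, zero_mul]))
  rw [h, smul_zero]

variable {Ω : Type*} [MeasurableSpace Ω] {P : Measure Ω} [IsProbabilityMeasure P]
  {N : PointProcess Ω (E × ℝ)} {b : ℝ}

/-- The number of points above a cell and the largest relative height above the cell. -/
lemma isCellPair (hf : Measurable f) (hf0 : ∀ x, 0 ≤ f x) (hfi : Integrable f ν) (hb : 0 ≤ b)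
    (hN : N.IsPoisson P (intensity ν f b)) {A : Set E} (hA : MeasurableSet A) :
    IsCellPair P (N.count (hypograph f A)) (maxMark N (relHeight f) (hypograph f A))
      (b * ∫ x in A, f x ∂ν) where
  measurable_fst := measurable_count N (measurableSet_hypograph hf hA)
  measurable_snd := measurable_maxMark N (measurable_relHeight hf) (measurableSet_hypograph hf hA)
    (relHeight_nonneg hf0)
  nonneg := maxMark_nonneg N (relHeight_nonneg hf0)
  le_one ω := (maxMark_le_iff N zero_le_one ω).2 fun i _ hi => relHeight_le_one hf0 hi
  eq_zero ω h := maxMark_eq_zero_of_count N _ h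
  law j w h0 h1 := by
    rw [hN.measureReal_count_eq_and_maxMark_le (measurable_relHeight hf)
      (measurableSet_hypograph hf hA) (intensity_hypograph_ne_top hf hf0 hfi hA) h0]
    have e1 := intensity_real_hypograph hf hf0 hfi hb hA zero_le_one le_rfl
    have e2 := intensity_real_hypograph hf hf0 hfi hb hA h0 h1
    have e3 := lowerPart_relHeight hf0 A h0 h1
    simp only [one_mul] at e1
    rw [e1, e3, e2, poissonWeight]
    ring

/-- A fluctuation is a function of the count and the largest relative height above its cell, and
these data are independent over disjoint cells. -/
lemma iIndepFun_fluctuation (hf : Measurable f) (hf0 : ∀ x, 0 ≤ f x)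
    (hN : N.IsPoisson P (intensity ν f b)) {ι : Type*} [Fintype ι] {I : ι → Set E}
    (hI : ∀ r, MeasurableSet (I r)) (hd : Pairwise fun r s => Disjoint (I r) (I s)) (lam : ι → ℝ) :
    iIndepFun (fun r => fluctuation (lam r) (N.count (hypograph f (I r)))
      (maxMark N (relHeight f) (hypograph f (I r)))) P := by
  have h := hN.iIndep_markEvents (measurable_relHeight hf) (fun r => hypograph f (I r))
    (fun r => measurableSet_hypograph hf (hI r)) (fun r s hrs => disjoint_hypograph (hd hrs))
    (fun r => relHeight_nonneg hf0)
  rw [iIndepFun_iff_iIndep]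
  exact iIndep_of_iIndep_of_le h fun r => comap_fluctuation_le
    (measurable_markEvents_count N (relHeight f) (hypograph f (I r)))
    (measurable_markEvents_maxMark N (D := hypograph f (I r)) (relHeight_nonneg hf0)) (lam r)

/-- The maximal height above a cell is close to the mean height times the largest relative
height. -/
lemma ae_abs_correctedMax_sub_le (hf : Measurable f) (hf0 : ∀ x, 0 ≤ f x)
    (hN : N.IsPoisson P (intensity ν f b)) {A : Set E} (hA : MeasurableSet A) {a Δ : ℝ} (ha : 0 < a)
    (hΔ : 0 ≤ Δ) (hosc : ∀ᵐ x ∂ν, x ∈ A → 0 < f x ∧ |f x - a| ≤ Δ) :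
    ∀ᵐ ω ∂P, |correctedMax N f A ω - a * ((1 + 1 / (N.count (hypograph f A) ω : ℝ)) *
      maxMark N (relHeight f) (hypograph f A) ω)| ≤ 2 * Δ := by
  -- Bad locations form a null set, above which there is almost surely no point.
  set B : Set E := {x | x ∈ A ∧ ¬ (0 < f x ∧ |f x - a| ≤ Δ)} with hB
  have hBm : MeasurableSet B := by
    have h1 : MeasurableSet {x | 0 < f x} := measurableSet_lt measurable_const hf
    have h2 : MeasurableSet {x | |f x - a| ≤ Δ} :=
      measurableSet_le (hf.sub_const a).abs measurable_const
    exact hA.inter (h1.inter h2).compl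
  have hB0 : ν B = 0 := by
    rw [ae_iff] at hosc
    convert hosc using 2
    ext x
    simp [hB]
  filter_upwards [hN.ae_count_eq_zero (hBm.prod MeasurableSet.univ) (intensity_eq_zero hB0)]
    with ω hω
  rw [count_eq_zero_iff] at hω
  have hgood : ∀ i < N.card ω, N.pt i ω ∈ hypograph f A →
      0 ≤ (N.pt i ω).2 ∧ |(N.pt i ω).2 - a * relHeight f (N.pt i ω)| ≤ Δ := by
    intro i hi hD
    have hnb : 0 < f (N.pt i ω).1 ∧ |f (N.pt i ω).1 - a| ≤ Δ := by
      by_contra hcon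
      exact hω i hi ⟨⟨hD.1, hcon⟩, Set.mem_univ _⟩
    refine ⟨hD.2.1, ?_⟩
    -- The first factor on the right lies in `[0, 1]`.
    have e : (N.pt i ω).2 - a * relHeight f (N.pt i ω) =
        relHeight f (N.pt i ω) * (f (N.pt i ω).1 - a) := by
      have := hnb.1.ne'
      unfold relHeight
      field_simp
    rw [e, abs_mul, abs_of_nonneg (relHeight_nonneg hf0 _ hD)]
    exact (mul_le_of_le_one_left (abs_nonneg _) (relHeight_le_one hf0 hD)).trans hnb.2
  set W := maxMark N (relHeight f) (hypograph f A) ω with hW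
  have hW0 : 0 ≤ W := maxMark_nonneg N (relHeight_nonneg hf0) ω
  have hH : maxHeight N (hypograph f A) ω = maxMark N Prod.snd (hypograph f A) ω := rfl
  have hY0 : 0 ≤ maxMark N Prod.snd (hypograph f A) ω :=
    maxMark_nonneg N (g := Prod.snd) (fun q hq => hq.2.1) ω
  set Y := maxMark N Prod.snd (hypograph f A) ω with hY
  -- Closeness at every point passes to the maxima, in both directions.
  have hYW : Y ≤ a * W + Δ := by
    refine (maxMark_le_iff N (by positivity) ω).2 fun i hi hD => ?_
    have h1 := (maxMark_le_iff N hW0 ω).1 le_rfl i hi hD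
    have h2 := (abs_le.1 (hgood i hi hD).2).2
    have h3 := mul_le_mul_of_nonneg_left h1 ha.le
    linarith
  have hWY : W ≤ (Y + Δ) / a := by
    refine (maxMark_le_iff N (by positivity) ω).2 fun i hi hD => ?_
    have h1 := (maxMark_le_iff N hY0 ω).1 le_rfl i hi hD
    have h2 := (abs_le.1 (hgood i hi hD).2).1
    rw [le_div_iff₀ ha]
    linarith
  rw [le_div_iff₀ ha] at hWY
  have hdiff : |Y - a * W| ≤ Δ := abs_le.2 ⟨by linarith, by linarith⟩
  rw [correctedMax, hH]
  have e : (1 + 1 / (N.count (hypograph f A) ω : ℝ)) * Y -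
      a * ((1 + 1 / (N.count (hypograph f A) ω : ℝ)) * W) =
      (1 + 1 / (N.count (hypograph f A) ω : ℝ)) * (Y - a * W) := by ring
  rw [e, abs_mul]
  -- The factor is `1` for an empty cell and at most `2` otherwise.
  have hfac : |1 + 1 / (N.count (hypograph f A) ω : ℝ)| ≤ 2 := by
    rw [abs_of_nonneg (by positivity)]
    rcases Nat.eq_zero_or_pos (N.count (hypograph f A) ω) with h0 | h0
    · simp [h0]
    · have h1 : (1 : ℝ) ≤ N.count (hypograph f A) ω := by exact_mod_cast h0
      have h2 : 1 / (N.count (hypograph f A) ω : ℝ) ≤ 1 := by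
        rw [div_le_one (by linarith)]; exact h1
      linarith
  exact mul_le_mul hfac hdiff (abs_nonneg _) (by norm_num)

lemma measurable_correctedMax (hf : Measurable f) {A : Set E} (hA : MeasurableSet A) :
    Measurable (correctedMax N f A) := by
  have h1 : Measurable fun ω => (N.count (hypograph f A) ω : ℝ) :=
    measurable_from_nat.comp (measurable_count N (measurableSet_hypograph hf hA))
  have h2 : Measurable (maxHeight N (hypograph f A)) :=
    measurable_maxMark N measurable_snd (measurableSet_hypograph hf hA) (fun q hq => hq.2.1)
  unfold correctedMax
  fun_prop

end Hypographs

/-! ### Cell averages and norms -/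

section Partitions

variable {E : Type*} [MeasurableSpace E] {ν : Measure E} [IsProbabilityMeasure ν] {k : ℕ}
  {I : Fin k → Set E} {f g h : E → ℝ}

lemma IsEqualMassPartition.exists_mem (hI : IsEqualMassPartition ν I) (t : E) : ∃ r, t ∈ I r := by
  have : t ∈ ⋃ r, I r := by rw [hI.iUnion_eq]; trivial
  simpa using this

lemma IsEqualMassPartition.pos (hI : IsEqualMassPartition ν I) : 0 < k := by
  obtain ⟨t⟩ := ν.nonempty_of_neZero
  obtain ⟨r, -⟩ := hI.exists_mem t
  exact r.pos

lemma IsEqualMassPartition.sum_setIntegral (hI : IsEqualMassPartition ν I) (hg : Integrable g ν) :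
    ∑ r, ∫ t in I r, g t ∂ν = ∫ t, g t ∂ν := by
  rw [← integral_iUnion_fintype hI.measurableSet hI.disjoint fun r => hg.integrableOn,
    hI.iUnion_eq, setIntegral_univ]

lemma IsEqualMassPartition.le_mean (hI : IsEqualMassPartition ν I) (hg : Integrable g ν) {r : Fin k}
    {a : ℝ} (ha : ∀ᵐ t ∂ν, t ∈ I r → a ≤ g t) : a ≤ k * ∫ t in I r, g t ∂ν := by
  have hk : (0 : ℝ) < k := by exact_mod_cast hI.pos
  have h1 := setIntegral_mono_on_ae (μ := ν) (s := I r) (f := fun _ => a) (g := g)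
    (integrable_const a).integrableOn hg.integrableOn (hI.measurableSet r) ha
  rw [setIntegral_const, hI.mass, smul_eq_mul, inv_mul_le_iff₀ hk] at h1
  exact h1

lemma IsEqualMassPartition.mean_le (hI : IsEqualMassPartition ν I) (hg : Integrable g ν) {r : Fin k}
    {a : ℝ} (ha : ∀ᵐ t ∂ν, t ∈ I r → g t ≤ a) : k * ∫ t in I r, g t ∂ν ≤ a := by
  have hk : (0 : ℝ) < k := by exact_mod_cast hI.pos
  have h1 := setIntegral_mono_on_ae (μ := ν) (s := I r) (f := g) (g := fun _ => a)
    hg.integrableOn (integrable_const a).integrableOn (hI.measurableSet r) ha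
  rw [setIntegral_const, hI.mass, smul_eq_mul, le_inv_mul_iff₀ hk] at h1
  exact h1

lemma IsEqualMassPartition.abs_mean_le (hI : IsEqualMassPartition ν I) (hg : Integrable g ν)
    {C : ℝ} (hC : ∀ t, |g t| ≤ C) (r : Fin k) : |k * ∫ t in I r, g t ∂ν| ≤ C :=
  abs_le.2 ⟨hI.le_mean hg (ae_of_all _ fun t _ => (abs_le.1 (hC t)).1),
    hI.mean_le hg (ae_of_all _ fun t _ => (abs_le.1 (hC t)).2)⟩

lemma IsEqualMassPartition.sum_abs_setIntegral_le (hI : IsEqualMassPartition ν I)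
    (hg : Integrable g ν) : ∑ r, |∫ t in I r, g t ∂ν| ≤ norm1 ν g := by
  rw [norm1, ← hI.sum_setIntegral hg.abs]
  exact Finset.sum_le_sum fun r _ => abs_integral_le_integral_abs

/-- Replacing a function by a step function that is uniformly close to it. -/
lemma IsEqualMassPartition.abs_integral_mul_sub_le (hI : IsEqualMassPartition ν I)
    (hh : Integrable h ν) (hgh : Integrable (fun t => g t * h t) ν) {a : Fin k → ℝ} {D : ℝ}
    (hD : ∀ r, ∀ᵐ t ∂ν, t ∈ I r → |g t - a r| ≤ D) :
    |∫ t, g t * h t ∂ν - ∑ r, a r * ∫ t in I r, h t ∂ν| ≤ D * norm1 ν h := by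
  rw [← hI.sum_setIntegral hgh, ← Finset.sum_sub_distrib, norm1, ← hI.sum_setIntegral hh.abs,
    Finset.mul_sum]
  refine (Finset.abs_sum_le_sum_abs _ _).trans (Finset.sum_le_sum fun r _ => ?_)
  rw [← integral_const_mul, ← integral_sub hgh.integrableOn (hh.integrableOn.const_mul _),
    ← integral_const_mul]
  refine abs_integral_le_integral_abs.trans ?_
  refine setIntegral_mono_on_ae (hgh.sub (hh.const_mul (a r))).abs.integrableOn
    (hh.abs.const_mul D).integrableOn (hI.measurableSet r) ?_
  filter_upwards [hD r] with t ht htr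
  rw [← sub_mul, abs_mul]
  exact mul_le_mul_of_nonneg_right (ht htr) (abs_nonneg _)

lemma integrable_mul_of_bounded (hg : Integrable g ν) (hh : Integrable h ν) {B : ℝ}
    (hB : ∀ t, |g t| ≤ B) : Integrable (fun t => g t * h t) ν :=
  hh.bdd_mul hg.aestronglyMeasurable (ae_of_all _ hB)

lemma Gam_bddAbove {B : ℝ} (hB : ∀ t, |g t| ≤ B) :
    BddAbove {d | ∃ r, ∃ s ∈ I r, ∃ t ∈ I r, d = g t - g s} := by
  refine ⟨2 * B, ?_⟩
  rintro d ⟨r, s, -, t, -, rfl⟩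
  have h1 := abs_le.1 (hB s)
  have h2 := abs_le.1 (hB t)
  linarith

lemma IsEqualMassPartition.abs_sub_mean_le_Gam (hI : IsEqualMassPartition ν I)
    (hg : Integrable g ν) {B : ℝ} (hB : ∀ t, |g t| ≤ B) {r : Fin k} {t : E} (ht : t ∈ I r) :
    |g t - k * ∫ s in I r, g s ∂ν| ≤ Gam I g := by
  have h1 : ∀ s ∈ I r, ∀ t ∈ I r, g t - g s ≤ Gam I g := fun s hs t ht =>
    le_csSup (Gam_bddAbove hB) ⟨r, s, hs, t, ht, rfl⟩
  rw [abs_le]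
  constructor
  · have := hI.mean_le hg (r := r) (a := g t + Gam I g) (ae_of_all _ fun s hs => by
      have := h1 t ht s hs
      linarith)
    linarith
  · have := hI.le_mean hg (r := r) (a := g t - Gam I g) (ae_of_all _ fun s hs => by
      have := h1 s hs t ht
      linarith)
    linarith

/-- Passing to cell averages changes inner products by little. -/
lemma IsEqualMassPartition.abs_integral_mul_sub_le_Gam (hI : IsEqualMassPartition ν I)
    (hg : Integrable g ν) (hh : Integrable h ν) {B : ℝ} (hB : ∀ t, |g t| ≤ B) :
    |∫ t, g t * h t ∂ν - k * ∑ r, (∫ t in I r, g t ∂ν) * ∫ t in I r, h t ∂ν| ≤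
      Gam I g * norm1 ν h := by
  have := hI.abs_integral_mul_sub_le hh (integrable_mul_of_bounded hg hh hB)
    (a := fun r => k * ∫ s in I r, g s ∂ν) fun r => ae_of_all _ fun t ht =>
      hI.abs_sub_mean_le_Gam hg hB ht
  rw [Finset.mul_sum]
  simpa only [mul_assoc] using this

/-- Almost every value of `f` on the cell, and its mean there, lie between the essential bounds on
the cell. Global bounds are needed because essential extrema of a real function are meaningful only
if it is essentially bounded. -/
lemma IsEqualMassPartition.ae_abs_sub_mean_le (hI : IsEqualMassPartition ν I) (hf : Measurable f)
    (hf0 : ∀ x, 0 ≤ f x) {B : ℝ} (hB : ∀ᵐ x ∂ν, f x ≤ B) (r : Fin k) :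
    ∀ᵐ x ∂ν, x ∈ I r → |f x - k * ∫ s in I r, f s ∂ν| ≤ cellOsc ν f I := by
  have hfi : Integrable f ν := Integrable.of_bound hf.aestronglyMeasurable B (by
    filter_upwards [hB] with x hx
    rwa [Real.norm_eq_abs, abs_of_nonneg (hf0 x)])
  have hle : essSup f (ν.restrict (I r)) - essInf f (ν.restrict (I r)) ≤ cellOsc ν f I :=
    le_ciSup (f := fun r => essSup f (ν.restrict (I r)) - essInf f (ν.restrict (I r)))
      (Set.finite_range _).bddAbove r
  have hup : ∀ᵐ x ∂ν, x ∈ I r → f x ≤ essSup f (ν.restrict (I r)) :=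
    (ae_restrict_iff' (hI.measurableSet r)).1
      (ae_le_essSup ⟨B, eventually_map.2 (ae_restrict_of_ae hB)⟩)
  have hlo : ∀ᵐ x ∂ν, x ∈ I r → essInf f (ν.restrict (I r)) ≤ f x :=
    (ae_restrict_iff' (hI.measurableSet r)).1
      (ae_essInf_le ⟨0, eventually_map.2 (ae_of_all _ hf0)⟩)
  have h1 := hI.mean_le hfi hup
  have h2 := hI.le_mean hfi hlo
  filter_upwards [hup, hlo] with x hx1 hx2 hx
  have h3 := hx1 hx
  have h4 := hx2 hx
  rw [abs_le]
  constructor <;> linarith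

lemma IsEqualMassPartition.cellOsc_nonneg (hI : IsEqualMassPartition ν I) (hf : Measurable f)
    (hf0 : ∀ x, 0 ≤ f x) {B : ℝ} (hB : ∀ᵐ x ∂ν, f x ≤ B) : 0 ≤ cellOsc ν f I := by
  have := ae_all_iff.2 (hI.ae_abs_sub_mean_le hf hf0 hB)
  obtain ⟨t, ht⟩ := this.exists
  obtain ⟨r, hr⟩ := hI.exists_mem t
  exact (abs_nonneg _).trans (ht r hr)

lemma norm2_nonneg (g : E → ℝ) : 0 ≤ norm2 ν g := Real.sqrt_nonneg _

/-- The variance of `|g|` under `ν` is nonnegative. -/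
lemma norm1_le_norm2 (hg : Integrable g ν) {B : ℝ} (hB : ∀ t, |g t| ≤ B) :
    norm1 ν g ≤ norm2 ν g := by
  refine Real.le_sqrt_of_sq_le ?_
  have hg2 : Integrable (fun t => g t ^ 2) ν := by
    simpa only [sq] using integrable_mul_of_bounded hg hg hB
  have h0 : 0 ≤ ∫ t, (|g t| - norm1 ν g) ^ 2 ∂ν := integral_nonneg fun _ => sq_nonneg _
  have e : ∫ t, (|g t| - norm1 ν g) ^ 2 ∂ν = ∫ t, g t ^ 2 ∂ν - norm1 ν g ^ 2 := by
    have : ∀ t, (|g t| - norm1 ν g) ^ 2 = g t ^ 2 - 2 * norm1 ν g * |g t| + norm1 ν g ^ 2 := by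
      intro t
      rw [← sq_abs (g t)]
      ring
    simp_rw [this]
    have hs : Integrable (fun t => g t ^ 2 - 2 * norm1 ν g * |g t|) ν :=
      hg2.sub (hg.abs.const_mul _)
    rw [integral_add hs (integrable_const _),
      integral_sub hg2 (hg.abs.const_mul _), integral_const_mul, ← norm1]
    simp
    ring
  linarith

lemma abs_le_normSup {B : ℝ} (hB : ∀ t, |g t| ≤ B) (t : E) : |g t| ≤ normSup g :=
  le_ciSup (f := fun t => |g t|) ⟨B, by rintro _ ⟨t, rfl⟩; exact hB t⟩ t

variable {Ω : Type*} [MeasurableSpace Ω] {N : PointProcess Ω (E × ℝ)}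

lemma IsEqualMassPartition.kernelEstimator_eq (hI : IsEqualMassPartition ν I) {K : E → E → ℝ}
    {x : E} (hK : Integrable (K x) ν) (ω : Ω) :
    kernelEstimator N ν f I K x ω = ∑ r, (∫ t in I r, K x t ∂ν) * correctedMax N f (I r) ω := by
  have h : ∀ t, K x t * geffroy N f I t ω =
      ∑ r, (I r).indicator (fun t => K x t * correctedMax N f (I r) ω) t := by
    intro t
    rw [geffroy, Finset.mul_sum]
    refine Finset.sum_congr rfl fun r _ => ?_
    by_cases ht : t ∈ I r <;> simp [ht]
  rw [kernelEstimator]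
  simp_rw [h]
  rw [integral_finsetSum _ fun r _ => (hK.mul_const _).indicator (hI.measurableSet r)]
  refine Finset.sum_congr rfl fun r _ => ?_
  rw [integral_indicator (hI.measurableSet r), integral_mul_const]

end Partitions

/-! ### Moment bounds uniform over the cells -/

section CellFluctuations

variable {Ω : Type*} [MeasurableSpace Ω] {P : Measure Ω} [IsProbabilityMeasure P]

/-- `|y|³ ≤ (y² + y⁴) / 2`, with second moment at most `5` and fourth at most `100`. -/
lemma IsCellPair.integral_abs_fluctuation_pow_three_le {N : Ω → ℕ} {W : Ω → ℝ} {lam : ℝ}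
    (h : IsCellPair P N W lam) (hl : 1 ≤ lam) :
    ∫ ω, |fluctuation lam N W ω| ^ 3 ∂P ≤ 53 := by
  have hl0 : 0 < lam := by linarith
  have h2 := h.integrable_fluctuation_pow hl0.le 2
  have h4 := h.integrable_fluctuation_pow hl0.le 4
  have h3 : Integrable (fun ω => |fluctuation lam N W ω| ^ 3) P := by
    have := (h.integrable_fluctuation_pow hl0.le 3).abs
    simpa only [abs_pow] using this
  have hle : ∫ ω, |fluctuation lam N W ω| ^ 3 ∂P ≤
      ∫ ω, (1 / 2 * fluctuation lam N W ω ^ 2 + 1 / 2 * fluctuation lam N W ω ^ 4) ∂P := by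
    refine integral_mono h3 ((h2.const_mul _).add (h4.const_mul _)) fun ω => ?_
    set y := fluctuation lam N W ω
    have e2 : y ^ 2 = |y| ^ 2 := (sq_abs y).symm
    have e4 : y ^ 4 = |y| ^ 4 := by rw [← abs_pow, abs_of_nonneg (by positivity)]
    change |y| ^ 3 ≤ 1 / 2 * y ^ 2 + 1 / 2 * y ^ 4
    rw [e2, e4]
    nlinarith [sq_nonneg (|y| * (|y| - 1))]
  rw [integral_add (h2.const_mul _) (h4.const_mul _), integral_const_mul, integral_const_mul] at hle
  have b2 := h.integral_fluctuation_sq_le hl0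
  have b4 := h.integral_fluctuation_pow_four_le hl0
  have : 4 / lam ≤ 4 := div_le_self (by norm_num) hl
  linarith

lemma IsCellPair.integral_abs_fluctuation_le {N : Ω → ℕ} {W : Ω → ℝ} {lam : ℝ}
    (h : IsCellPair P N W lam) (hl : 1 ≤ lam) :
    ∫ ω, |fluctuation lam N W ω| ∂P ≤ 3 := by
  have hl0 : 0 < lam := by linarith
  have h2 := h.integrable_fluctuation_pow hl0.le 2
  have h1 : Integrable (fun ω => |fluctuation lam N W ω|) P := by
    simpa using (h.integrable_fluctuation_pow hl0.le 1).abs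
  have hle : ∫ ω, |fluctuation lam N W ω| ∂P ≤
      ∫ ω, (1 / 2 + 1 / 2 * fluctuation lam N W ω ^ 2) ∂P := by
    refine integral_mono h1 ((integrable_const _).add (h2.const_mul _)) fun ω => ?_
    change |fluctuation lam N W ω| ≤ 1 / 2 + 1 / 2 * fluctuation lam N W ω ^ 2
    rw [← sq_abs (fluctuation lam N W ω)]
    nlinarith [sq_nonneg (|fluctuation lam N W ω| - 1)]
  rw [integral_add (integrable_const _) (h2.const_mul _), integral_const_mul] at hle
  have b2 := h.integral_fluctuation_sq_le hl0
  have : 4 / lam ≤ 4 := div_le_self (by norm_num) hl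
  simp at hle
  linarith

/-- Half of the exponent in `lam e^{-lam}` is spent on the factor `lam`; the other half decreases in
`lam`, hence a bound common to all cells with mean count at least `l`. -/
lemma IsCellPair.abs_integral_fluctuation_le {N : Ω → ℕ} {W : Ω → ℝ} {lam l : ℝ}
    (h : IsCellPair P N W lam) (hl0 : 0 ≤ lam) (hl : l ≤ lam) :
    |∫ ω, fluctuation lam N W ω ∂P| ≤ 2 * Real.exp (-(l / 2)) := by
  rw [h.integral_fluctuation hl0, abs_neg, abs_of_nonneg (by positivity)]
  have h1 : lam / 2 ≤ Real.exp (lam / 2) := by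
    have := Real.add_one_le_exp (lam / 2); linarith
  have h2 : Real.exp (-lam) = Real.exp (-(lam / 2)) * Real.exp (-(lam / 2)) := by
    rw [← Real.exp_add]; ring_nf
  have h3 : Real.exp (-(lam / 2)) ≤ Real.exp (-(l / 2)) := Real.exp_le_exp.2 (by linarith)
  have h4 : lam / 2 * Real.exp (-(lam / 2)) ≤ 1 := by
    rw [Real.exp_neg, mul_inv_le_iff₀ (Real.exp_pos _)]
    linarith
  have h5 := Real.exp_pos (-(lam / 2))
  rw [h2]
  nlinarith

lemma IsCellPair.abs_integral_fluctuation_sq_sub_le {N : Ω → ℕ} {W : Ω → ℝ} {lam l : ℝ}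
    (h : IsCellPair P N W lam) (hl0 : 0 < l) (hl : l ≤ lam) :
    |∫ ω, fluctuation lam N W ω ^ 2 ∂P - 1| ≤ 4 / l := by
  have h0 : 0 < lam := hl0.trans_le hl
  have h1 := h.integral_fluctuation_sq_le h0
  have h2 := h.integral_fluctuation_sq_ge h0
  have h3 : 4 / lam ≤ 4 / l := div_le_div_of_nonneg_left (by norm_num) hl0 hl
  have h4 : 2 / lam ≤ 4 / lam := by gcongr; norm_num
  rw [abs_le]
  constructor <;> linarith

end CellFluctuations

/-! ### Linearisation of the corrected maxima -/

section Cells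

variable {E : Type*} [MeasurableSpace E] {ν : Measure E} [IsProbabilityMeasure ν] {k : ℕ}
  {I : Fin k → Set E} {f : E → ℝ}
  {Ω : Type*} [MeasurableSpace Ω] {P : Measure Ω} [IsProbabilityMeasure P]
  {N : PointProcess Ω (E × ℝ)} {b : ℝ}

/-- The fluctuation attached to the cell `I r`, when the intensity of the process is `b`. -/
def cellFluct (N : PointProcess Ω (E × ℝ)) (ν : Measure E) (f : E → ℝ) (b : ℝ) (I : Fin k → Set E)
    (r : Fin k) : Ω → ℝ :=
  fluctuation (b * ∫ t in I r, f t ∂ν) (N.count (hypograph f (I r)))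
    (maxMark N (relHeight f) (hypograph f (I r)))

lemma integrable_of_ae_le (hf : Measurable f) (hf0 : ∀ x, 0 ≤ f x) {B : ℝ}
    (hB : ∀ᵐ x ∂ν, f x ≤ B) : Integrable f ν :=
  Integrable.of_bound hf.aestronglyMeasurable B (by
    filter_upwards [hB] with x hx
    rwa [Real.norm_eq_abs, abs_of_nonneg (hf0 x)])

lemma ae_essInf_le_self (hf0 : ∀ x, 0 ≤ f x) : ∀ᵐ x ∂ν, essInf f ν ≤ f x :=
  ae_essInf_le ⟨0, eventually_map.2 (ae_of_all _ hf0)⟩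

lemma IsEqualMassPartition.essInf_le_mean (hI : IsEqualMassPartition ν I) (hf0 : ∀ x, 0 ≤ f x)
    (hfi : Integrable f ν) (r : Fin k) : essInf f ν ≤ k * ∫ t in I r, f t ∂ν :=
  hI.le_mean hfi ((ae_essInf_le_self hf0).mono fun _ h _ => h)

/-- The corrected maximum in a cell is the mean of the boundary function plus a multiple of the
fluctuation, up to the oscillation of the boundary function. -/
lemma ae_abs_correctedMax_sub_cellFluct_le (hI : IsEqualMassPartition ν I) (hf : Measurable f)
    (hf0 : ∀ x, 0 ≤ f x) (hm : 0 < essInf f ν) {B : ℝ} (hB : ∀ᵐ x ∂ν, f x ≤ B) (hb : 0 < b)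
    (hN : N.IsPoisson P (intensity ν f b)) :
    ∀ᵐ ω ∂P, ∀ r, |correctedMax N f (I r) ω - (k * ∫ t in I r, f t ∂ν +
      k / b * cellFluct N ν f b I r ω)| ≤ 2 * cellOsc ν f I := by
  rw [ae_all_iff]
  intro r
  have hfi := integrable_of_ae_le hf hf0 hB
  have h := ae_abs_correctedMax_sub_le hf hf0 hN (hI.measurableSet r)
    (hm.trans_le (hI.essInf_le_mean hf0 hfi r)) (hI.cellOsc_nonneg hf hf0 hB) (by
      filter_upwards [hI.ae_abs_sub_mean_le hf hf0 hB r, ae_essInf_le_self hf0] with x h1 h2 hx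
      exact ⟨hm.trans_le h2, h1 hx⟩)
  filter_upwards [h] with ω hω
  convert hω using 2
  -- With `a = k ∫_I f` and `lam = b ∫_I f` one has `a / lam = k / b`, so `a (1 + 1/N) W = a + (k /
  -- b) V`.
  rw [cellFluct, fluctuation]
  field_simp
  ring

/-- The corrected maximum is bounded. -/
lemma ae_abs_correctedMax_le (hI : IsEqualMassPartition ν I) (hf : Measurable f)
    (hf0 : ∀ x, 0 ≤ f x) (hm : 0 < essInf f ν) {B : ℝ} (hB : ∀ᵐ x ∂ν, f x ≤ B) (hb : 0 < b)
    (hN : N.IsPoisson P (intensity ν f b)) :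
    ∀ᵐ ω ∂P, ∀ r, |correctedMax N f (I r) ω| ≤ 2 * cellOsc ν f I + 2 * B := by
  have hfi := integrable_of_ae_le hf hf0 hB
  filter_upwards [ae_abs_correctedMax_sub_cellFluct_le hI hf hf0 hm hB hb hN] with ω hω r
  have h1 := hω r
  have hk : (0 : ℝ) < k := by exact_mod_cast hI.pos
  have hA : 0 ≤ ∫ t in I r, f t ∂ν := integral_nonneg hf0
  have h2 := (isCellPair hf hf0 hfi hb.le hN (hI.measurableSet r)).abs_fluctuation_le
    (mul_nonneg hb.le hA) ω
  rw [← cellFluct] at h2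
  have h3 : k * ∫ t in I r, f t ∂ν ≤ B := hI.mean_le hfi (hB.mono fun _ h _ => h)
  -- Since `|V| ≤ lam`, the stochastic part never exceeds the cell mean of `f`.
  have h4 : |k / b * cellFluct N ν f b I r ω| ≤ k * ∫ t in I r, f t ∂ν := by
    rw [abs_mul, abs_of_nonneg (by positivity)]
    calc _ ≤ k / b * (b * ∫ t in I r, f t ∂ν) := by gcongr
      _ = _ := by field_simp
  have h5 := abs_le.1 h1
  have h6 := abs_le.1 h4
  have h7 := mul_nonneg hk.le hA
  rw [abs_le]
  constructor <;> linarith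

/-- The distance of a linear combination of the corrected maxima to its stochastic part. -/
lemma ae_abs_weighted_sum_sub_le (hI : IsEqualMassPartition ν I) (hf : Measurable f)
    (hf0 : ∀ x, 0 ≤ f x) (hm : 0 < essInf f ν) {B : ℝ} (hB : ∀ᵐ x ∂ν, f x ≤ B) (hb : 0 < b)
    (hN : N.IsPoisson P (intensity ν f b)) {K : E → E → ℝ} {x : E} (hK : Integrable (K x) ν)
    {C : ℝ} (hC : ∀ t, |K x t| ≤ C) (u : Fin k → ℝ) :
    ∀ᵐ ω ∂P, |∑ r, u r * correctedMax N f (I r) ω - f x -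
        k / b * ∑ r, (∫ t in I r, K x t ∂ν) * cellFluct N ν f b I r ω| ≤
      (2 * cellOsc ν f I + 2 * B) * ∑ r, |u r - ∫ t in I r, K x t ∂ν| +
        4 * max (Psi ν f K x) (cellOsc ν f I * norm1 ν (K x)) := by
  have hfi := integrable_of_ae_le hf hf0 hB
  filter_upwards [ae_abs_correctedMax_sub_cellFluct_le hI hf hf0 hm hB hb hN,
    ae_abs_correctedMax_le hI hf hf0 hm hB hb hN] with ω h1 h2
  set w : Fin k → ℝ := fun r => ∫ t in I r, K x t ∂ν with hw
  set U : Fin k → ℝ := fun r => correctedMax N f (I r) ω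
  set a : Fin k → ℝ := fun r => k * ∫ t in I r, f t ∂ν
  set V : Fin k → ℝ := fun r => cellFluct N ν f b I r ω
  have hint : Integrable (fun t => f t * K x t) ν := by
    simpa only [mul_comm] using integrable_mul_of_bounded hK hfi hC
  have h3 : |∫ t, f t * K x t ∂ν - ∑ r, a r * w r| ≤ cellOsc ν f I * norm1 ν (K x) :=
    hI.abs_integral_mul_sub_le hK hint fun r => hI.ae_abs_sub_mean_le hf hf0 hB r
  have h4 : |∫ t, f t * K x t ∂ν - f x| = Psi ν f K x := by
    rw [Psi]; simp_rw [mul_comm]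
  have h5 : |∑ r, (u r - w r) * U r| ≤
      (2 * cellOsc ν f I + 2 * B) * ∑ r, |u r - w r| := by
    refine (Finset.abs_sum_le_sum_abs _ _).trans ?_
    rw [Finset.mul_sum]
    refine Finset.sum_le_sum fun r _ => ?_
    rw [abs_mul, mul_comm]
    exact mul_le_mul_of_nonneg_right (h2 r) (abs_nonneg _)
  have h6 : |∑ r, w r * (U r - (a r + k / b * V r))| ≤ 2 * (cellOsc ν f I * norm1 ν (K x)) := by
    refine (Finset.abs_sum_le_sum_abs _ _).trans ?_
    have : 0 ≤ 2 * cellOsc ν f I := mul_nonneg zero_le_two (hI.cellOsc_nonneg hf hf0 hB)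
    calc ∑ r, |w r * (U r - (a r + k / b * V r))| ≤ ∑ r, |w r| * (2 * cellOsc ν f I) :=
          Finset.sum_le_sum fun r _ => by
            rw [abs_mul]
            exact mul_le_mul_of_nonneg_left (h1 r) (abs_nonneg _)
      _ = (∑ r, |w r|) * (2 * cellOsc ν f I) := by rw [Finset.sum_mul]
      _ ≤ norm1 ν (K x) * (2 * cellOsc ν f I) :=
          mul_le_mul_of_nonneg_right (hI.sum_abs_setIntegral_le hK) this
      _ = _ := by ring
  -- Four errors: general weights instead of cell integrals, linearisation of the maxima, `f`
  -- replaced by its cell means, and the kernel bias. The last three cost `2`, `1` and `1` times the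
  -- maximum.
  have e : ∑ r, u r * U r - f x - k / b * ∑ r, w r * V r =
      ∑ r, (u r - w r) * U r + ∑ r, w r * (U r - (a r + k / b * V r)) -
        (∫ t, f t * K x t ∂ν - ∑ r, a r * w r) + (∫ t, f t * K x t ∂ν - f x) := by
    have e1 : ∑ r, w r * (U r - (a r + k / b * V r)) =
        ∑ r, w r * U r - ∑ r, a r * w r - k / b * ∑ r, w r * V r := by
      rw [Finset.mul_sum, ← Finset.sum_sub_distrib, ← Finset.sum_sub_distrib]
      exact Finset.sum_congr rfl fun r _ => by ring
    have e2 : ∑ r, (u r - w r) * U r = ∑ r, u r * U r - ∑ r, w r * U r := by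
      rw [← Finset.sum_sub_distrib]
      exact Finset.sum_congr rfl fun r _ => by ring
    rw [e1, e2]
    ring
  change |∑ r, u r * U r - f x - k / b * ∑ r, w r * V r| ≤
    (2 * cellOsc ν f I + 2 * B) * ∑ r, |u r - w r| +
      4 * max (Psi ν f K x) (cellOsc ν f I * norm1 ν (K x))
  rw [e]
  have m1 := h4.le.trans (le_max_left (Psi ν f K x) (cellOsc ν f I * norm1 ν (K x)))
  have m2 := le_max_right (Psi ν f K x) (cellOsc ν f I * norm1 ν (K x))
  have g3 := abs_le.1 h3
  have g5 := abs_le.1 h5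
  have g6 := abs_le.1 h6
  have g4 := abs_le.1 m1
  rw [abs_le]
  constructor <;> linarith

end Cells

/-! ### Consequences of the growth condition on the number of cells -/

section Rates

lemma tendsto_div_of_log {k : ℕ → ℕ}
    (hk_log : Tendsto (fun n : ℕ => (n : ℝ)⁻¹ * k n * Real.log n) atTop (𝓝 0)) :
    Tendsto (fun n : ℕ => (k n : ℝ) / n) atTop (𝓝 0) := by
  refine squeeze_zero' (Eventually.of_forall fun n => by positivity) ?_ hk_log
  filter_upwards [eventually_ge_atTop 3] with n hn
  have h3 : (3 : ℝ) ≤ n := by exact_mod_cast hn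
  have h1 : 1 ≤ Real.log n := by
    rw [Real.le_log_iff_exp_le (by linarith)]
    exact (Real.exp_one_lt_d9.le.trans (by norm_num)).trans h3
  rw [div_eq_inv_mul]
  exact le_mul_of_one_le_right (by positivity) h1

lemma tendsto_div_atTop_of_log {k : ℕ → ℕ} (hk : ∀ n, 0 < k n)
    (hk_log : Tendsto (fun n : ℕ => (n : ℝ)⁻¹ * k n * Real.log n) atTop (𝓝 0)) {a : ℝ}
    (ha : 0 < a) : Tendsto (fun n : ℕ => a * (n / (k n : ℝ))) atTop atTop := by
  refine Tendsto.const_mul_atTop ha ?_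
  have h : Tendsto (fun n : ℕ => (k n : ℝ) / n) atTop (𝓝[>] 0) := by
    refine tendsto_nhdsWithin_iff.2 ⟨tendsto_div_of_log hk_log, ?_⟩
    filter_upwards [eventually_gt_atTop 0] with n hn
    have h1 : (0 : ℝ) < k n := by exact_mod_cast hk n
    have h2 : (0 : ℝ) < n := by exact_mod_cast hn
    exact Set.mem_Ioi.2 (by positivity)
  refine h.inv_tendsto_nhdsGT_zero.congr fun n => ?_
  simp

/-- Here the logarithm is used in full: eventually `log n ≤ a n / (2 k)`, so the exponential is at
most `1 / n`, and `√k ≤ k` leaves `k / n`. This controls the total mean caused by empty cells. -/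
lemma tendsto_sqrt_mul_exp_of_log {k : ℕ → ℕ} (hk : ∀ n, 0 < k n)
    (hk_log : Tendsto (fun n : ℕ => (n : ℝ)⁻¹ * k n * Real.log n) atTop (𝓝 0)) {a : ℝ}
    (ha : 0 < a) :
    Tendsto (fun n : ℕ => √(k n : ℝ) * Real.exp (-(a * (n / (k n : ℝ)) / 2))) atTop (𝓝 0) := by
  refine squeeze_zero' (Eventually.of_forall fun n => by positivity) ?_ (tendsto_div_of_log hk_log)
  filter_upwards [eventually_gt_atTop 0, hk_log.eventually_lt_const (half_pos ha)] with n hn h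
  have h1 : (1 : ℝ) ≤ k n := by exact_mod_cast hk n
  have h2 : (0 : ℝ) < n := by exact_mod_cast hn
  have h3 : Real.log n ≤ a * (n / (k n : ℝ)) / 2 := by
    have e : a * (n / (k n : ℝ)) / 2 = a / 2 * n / k n := by ring
    rw [e, le_div_iff₀ (by linarith)]
    have : (n : ℝ)⁻¹ * k n * Real.log n = (Real.log n * k n) / n := by ring
    rw [this, div_lt_iff₀ h2] at h
    linarith
  have h4 : Real.exp (-(a * (n / (k n : ℝ)) / 2)) ≤ (n : ℝ)⁻¹ := by
    rw [Real.exp_neg]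
    refine inv_anti₀ h2 ?_
    calc (n : ℝ) = Real.exp (Real.log n) := (Real.exp_log h2).symm
      _ ≤ _ := Real.exp_le_exp.2 h3
  have h5 : √(k n : ℝ) ≤ k n := by
    rw [Real.sqrt_le_left (by linarith)]
    nlinarith
  rw [div_eq_mul_inv]
  exact mul_le_mul h5 h4 (Real.exp_pos _).le (by linarith)

end Rates

/-! ### Weights of the cells in the standardised estimator -/

section Weights

variable {E : Type*} [MeasurableSpace E] {ν : Measure E} [IsProbabilityMeasure ν]

/-- The weight of a cell in the standardised kernel estimator. -/
def cellWeight (ν : Measure E) {k : ℕ} (I : Fin k → Set E) (g : E → ℝ) (r : Fin k) : ℝ :=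
  √(k : ℝ) * (norm2 ν g)⁻¹ * ∫ t in I r, g t ∂ν

lemma abs_cellWeight_le {k : ℕ} {I : Fin k → Set E} (hI : IsEqualMassPartition ν I) {g : E → ℝ}
    (hg : Integrable g ν) {B : ℝ} (hB : ∀ t, |g t| ≤ B) (r : Fin k) :
    |cellWeight ν I g r| ≤ (√(k : ℝ))⁻¹ * (norm2 ν g)⁻¹ * normSup g := by
  have hk : (0 : ℝ) < k := by exact_mod_cast hI.pos
  have h1 := hI.abs_mean_le hg (abs_le_normSup hB) r
  rw [abs_mul, abs_of_pos hk] at h1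
  have hs : (√(k : ℝ))⁻¹ * k = √(k : ℝ) := by
    have := Real.mul_self_sqrt hk.le
    have h0 : √(k : ℝ) ≠ 0 := (Real.sqrt_pos.2 hk).ne'
    field_simp
    linarith
  have hn := norm2_nonneg (ν := ν) g
  rw [cellWeight, abs_mul, abs_of_nonneg (by positivity)]
  calc √(k : ℝ) * (norm2 ν g)⁻¹ * |∫ t in I r, g t ∂ν|
      = (√(k : ℝ))⁻¹ * (norm2 ν g)⁻¹ * (k * |∫ t in I r, g t ∂ν|) := by
        linear_combination (-(norm2 ν g)⁻¹ * |∫ t in I r, g t ∂ν|) * hs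
    _ ≤ _ := by gcongr

lemma sum_abs_cellWeight_le {k : ℕ} {I : Fin k → Set E} (hI : IsEqualMassPartition ν I) {g : E → ℝ}
    (hg : Integrable g ν) {B : ℝ} (hB : ∀ t, |g t| ≤ B) :
    ∑ r, |cellWeight ν I g r| ≤ √(k : ℝ) := by
  have hn := norm2_nonneg (ν := ν) g
  have h0 : 0 ≤ √(k : ℝ) * (norm2 ν g)⁻¹ := by positivity
  simp_rw [cellWeight, abs_mul _ (∫ t in I _, g t ∂ν), abs_of_nonneg h0]
  rw [← Finset.mul_sum, mul_assoc]
  refine mul_le_of_le_one_right (by positivity) ?_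
  calc (norm2 ν g)⁻¹ * ∑ r, |∫ t in I r, g t ∂ν| ≤ (norm2 ν g)⁻¹ * norm2 ν g := by
        gcongr
        exact (hI.sum_abs_setIntegral_le hg).trans (norm1_le_norm2 hg hB)
    _ ≤ 1 := inv_mul_le_one

/-- The sum is the normalised inner product of the cellwise averaged kernels. Averaging one factor
changes the inner product by at most `Gam * norm1`, which `h1` makes negligible. -/
lemma tendsto_sum_cellWeight_mul {k : ℕ → ℕ} {I : (n : ℕ) → Fin (k n) → Set E}
    (hI : ∀ n, IsEqualMassPartition ν (I n)) {g h : ℕ → E → ℝ} (hg : ∀ n, Integrable (g n) ν)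
    (hh : ∀ n, Integrable (h n) ν) (hgB : ∀ᶠ n in atTop, ∃ B, ∀ t, |g n t| ≤ B)
    (hgpos : ∀ᶠ n in atTop, norm2 ν (g n) ≠ 0) (hhpos : ∀ᶠ n in atTop, norm2 ν (h n) ≠ 0)
    (h1 : (fun n => Gam (I n) (g n) * norm1 ν (h n))
        =o[atTop] (fun n => norm2 ν (g n) * norm2 ν (h n))) {s : ℝ}
    (h2 : Tendsto (fun n => (∫ t, g n t * h n t ∂ν) *
        (norm2 ν (g n) * norm2 ν (h n))⁻¹) atTop (𝓝 s)) :
    Tendsto (fun n => ∑ r, cellWeight ν (I n) (g n) r * cellWeight ν (I n) (h n) r) atTop (𝓝 s) := by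
  have h3 := h1.tendsto_div_nhds_zero
  have h4 : Tendsto (fun n => ∑ r, cellWeight ν (I n) (g n) r * cellWeight ν (I n) (h n) r -
      (∫ t, g n t * h n t ∂ν) * (norm2 ν (g n) * norm2 ν (h n))⁻¹) atTop (𝓝 0) := by
    refine squeeze_zero_norm' ?_ h3
    filter_upwards [hgB, hgpos, hhpos] with n ⟨B, hB⟩ hg0 hh0
    have hp : 0 ≤ (norm2 ν (g n) * norm2 ν (h n))⁻¹ :=
      inv_nonneg.2 (mul_nonneg (norm2_nonneg _) (norm2_nonneg _))
    have e : ∑ r, cellWeight ν (I n) (g n) r * cellWeight ν (I n) (h n) r =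
        (k n * ∑ r, (∫ t in I n r, g n t ∂ν) * ∫ t in I n r, h n t ∂ν) *
          (norm2 ν (g n) * norm2 ν (h n))⁻¹ := by
      rw [Finset.mul_sum, Finset.sum_mul]
      refine Finset.sum_congr rfl fun r _ => ?_
      rw [cellWeight, cellWeight]
      have : √(k n : ℝ) * √(k n : ℝ) = k n := Real.mul_self_sqrt (Nat.cast_nonneg _)
      rw [mul_inv]
      linear_combination ((norm2 ν (g n))⁻¹ * (norm2 ν (h n))⁻¹ * (∫ t in I n r, g n t ∂ν) *
        ∫ t in I n r, h n t ∂ν) * this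
    rw [e, ← sub_mul, Real.norm_eq_abs, abs_mul, abs_of_nonneg hp, div_eq_mul_inv, abs_sub_comm]
    exact mul_le_mul_of_nonneg_right ((hI n).abs_integral_mul_sub_le_Gam (hg n) (hh n) hB) hp
  simpa using h4.add h2

end Weights

/-! ### Limits of Gram matrices -/

section Gram

variable {ι : Type*} [Fintype ι] {κ : ℕ → Type*} [∀ n, Fintype (κ n)]
  {a : (n : ℕ) → ι → κ n → ℝ} {S : Matrix ι ι ℝ}

-- This serves both for the positivity of the limit matrix and as the limiting variance of the sum
-- projected on `t`.
open scoped Matrix in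
lemma tendsto_sum_sq_of_tendsto_gram
    (h : ∀ i j, Tendsto (fun n => ∑ r, a n i r * a n j r) atTop (𝓝 (S i j))) (t : ι → ℝ) :
    Tendsto (fun n => ∑ r, (∑ i, t i * a n i r) ^ 2) atTop (𝓝 (t ⬝ᵥ S *ᵥ t)) := by
  have h1 : Tendsto (fun n => ∑ i, ∑ j, t i * t j * ∑ r, a n i r * a n j r) atTop
      (𝓝 (∑ i, ∑ j, t i * t j * S i j)) :=
    tendsto_finsetSum _ fun i _ => tendsto_finsetSum _ fun j _ => (h i j).const_mul _
  have e1 : t ⬝ᵥ S *ᵥ t = ∑ i, ∑ j, t i * t j * S i j := by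
    simp only [dotProduct, Matrix.mulVec, Finset.mul_sum]
    exact Finset.sum_congr rfl fun i _ => Finset.sum_congr rfl fun j _ => by ring
  rw [e1]
  refine h1.congr fun n => ?_
  simp_rw [sq, Finset.sum_mul_sum, Finset.mul_sum]
  rw [Finset.sum_comm (s := (Finset.univ : Finset (κ n)))]
  refine Finset.sum_congr rfl fun i _ => ?_
  rw [Finset.sum_comm (s := (Finset.univ : Finset (κ n)))]
  exact Finset.sum_congr rfl fun j _ => Finset.sum_congr rfl fun r _ => by ring

/-- The limit of Gram matrices is positive semidefinite. -/
lemma posSemidef_of_tendsto_gram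
    (h : ∀ i j, Tendsto (fun n => ∑ r, a n i r * a n j r) atTop (𝓝 (S i j))) :
    S.PosSemidef := by
  refine Matrix.PosSemidef.of_dotProduct_mulVec_nonneg ?_ fun t => ?_
  · ext i j
    simp only [Matrix.conjTranspose_apply, star_trivial]
    refine tendsto_nhds_unique (h j i) ((h i j).congr fun n => ?_)
    exact Finset.sum_congr rfl fun r _ => mul_comm _ _
  · rw [star_trivial]
    exact ge_of_tendsto (tendsto_sum_sq_of_tendsto_gram h t)
      (Eventually.of_forall fun n => Finset.sum_nonneg fun r _ => sq_nonneg _)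

end Gram

/-! ### Central limit theorem for triangular arrays -/

section CentralLimit

variable {p : ℕ} {Ω : ℕ → Type*} [∀ n, MeasurableSpace (Ω n)] {P : (n : ℕ) → Measure (Ω n)}
  [∀ n, IsProbabilityMeasure (P n)] {k : ℕ → ℕ}

open scoped Matrix in
/-- A multivariate central limit theorem for weighted sums in a triangular array. -/
lemma tendstoInDistribution_weighted_sum {a : (n : ℕ) → Fin p → Fin (k n) → ℝ}
    {S : Matrix (Fin p) (Fin p) ℝ}
    (hS : ∀ i j, Tendsto (fun n => ∑ r, a n i r * a n j r) atTop (𝓝 (S i j)))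
    {β : Fin p → ℕ → ℝ} (hβ : ∀ i, Tendsto (β i) atTop (𝓝 0))
    (haβ : ∀ i, ∀ᶠ n in atTop, ∀ r, |a n i r| ≤ β i n)
    {s : ℕ → ℝ} (has : ∀ i, ∀ᶠ n in atTop, ∑ r, |a n i r| ≤ s n)
    {V : (n : ℕ) → Fin (k n) → Ω n → ℝ} (hV : ∀ n r, Measurable (V n r))
    (hind : ∀ᶠ n in atTop, iIndepFun (V n) (P n))
    (hbd : ∀ᶠ n in atTop, ∃ B, ∀ r ω, |V n r ω| ≤ B) {η δ : ℕ → ℝ} {M : ℝ}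
    (h1 : ∀ᶠ n in atTop, ∀ r, |∫ ω, V n r ω ∂P n| ≤ η n)
    (h2 : ∀ᶠ n in atTop, ∀ r, |∫ ω, V n r ω ^ 2 ∂P n - 1| ≤ δ n)
    (h3 : ∀ᶠ n in atTop, ∀ r, ∫ ω, |V n r ω| ^ 3 ∂P n ≤ M) (hM : 0 ≤ M)
    (hη0 : ∀ n, 0 ≤ η n) (hη : Tendsto (fun n => s n * η n) atTop (𝓝 0))
    (hδ : Tendsto δ atTop (𝓝 0)) :
    TendstoInDistribution (fun n ω => (WithLp.toLp 2 fun j => ∑ r, a n j r * V n r ω :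
      EuclideanSpace ℝ (Fin p))) atTop id P (multivariateGaussian 0 S) := by
  have hmeas : ∀ n, Measurable fun ω => (WithLp.toLp 2 fun j => ∑ r, a n j r * V n r ω :
      EuclideanSpace ℝ (Fin p)) := fun n => by
    have := hV n
    fun_prop
  refine ⟨fun n => (hmeas n).aemeasurable, by fun_prop, ?_⟩
  refine ProbabilityMeasure.tendsto_iff_tendsto_charFun.2 fun t => ?_
  -- The formula for the Gaussian characteristic function requires this.
  have hPSD := posSemidef_of_tendsto_gram hS
  have hcf : ∀ n, charFun ((P n).map fun ω => (WithLp.toLp 2 fun j => ∑ r, a n j r * V n r ω :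
      EuclideanSpace ℝ (Fin p))) t =
      ∫ ω, Complex.exp ((∑ r, (∑ i, t i * a n i r) * V n r ω : ℝ) * Complex.I) ∂P n := by
    intro n
    rw [charFun_apply, integral_map (hmeas n).aemeasurable (by fun_prop)]
    congr 1
    funext ω
    congr 3
    simp only [PiLp.inner_apply, Real.inner_apply, Finset.sum_mul]
    rw [Finset.sum_comm]
    exact Finset.sum_congr rfl fun r _ => Finset.sum_congr rfl fun j _ => by ring
  have hlim : charFun ((multivariateGaussian 0 S).map id) t =
      ((Real.exp (-((t.ofLp ⬝ᵥ S *ᵥ t.ofLp) / 2)) : ℝ) : ℂ) := by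
    rw [Measure.map_id, charFun_multivariateGaussian hPSD]
    simp
  change Tendsto (fun n => charFun ((P n).map fun ω => (WithLp.toLp 2 fun j =>
    ∑ r, a n j r * V n r ω : EuclideanSpace ℝ (Fin p))) t) atTop
    (𝓝 (charFun ((multivariateGaussian 0 S).map id) t))
  simp_rw [hcf]
  rw [hlim]
  have hsq := tendsto_sum_sq_of_tendsto_gram hS t.ofLp
  have hG : Tendsto (fun n => ((Real.exp (-((∑ r, (∑ i, t i * a n i r) ^ 2) / 2)) : ℝ) : ℂ)) atTop
      (𝓝 ((Real.exp (-((t.ofLp ⬝ᵥ S *ᵥ t.ofLp) / 2)) : ℝ) : ℂ)) :=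
    (Complex.continuous_ofReal.tendsto _).comp
      ((Real.continuous_exp.tendsto _).comp ((hsq.div_const 2).neg))
  set b : ℕ → ℝ := fun n => ∑ i, |t i| * β i n with hb
  have hb0 : Tendsto b atTop (𝓝 0) := by
    have := tendsto_finsetSum Finset.univ fun i _ => (hβ i).const_mul |t i|
    simpa using this
  -- The mean error `η` meets the `ℓ¹` norm of the weights, which may grow like `s`; the other
  -- errors meet the squared `ℓ²` norm, which converges.
  have hup : Tendsto (fun n => (∑ i, |t i|) * (s n * η n) + (δ n + 4 * M * b n + b n ^ 2) *
      ∑ r, (∑ i, t i * a n i r) ^ 2) atTop (𝓝 0) := by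
    have := (hη.const_mul (∑ i, |t i|)).add
      (((hδ.add (hb0.const_mul (4 * M))).add (hb0.pow 2)).mul hsq)
    simpa using this
  have hdiff : Tendsto (fun n =>
      ∫ ω, Complex.exp ((∑ r, (∑ i, t i * a n i r) * V n r ω : ℝ) * Complex.I) ∂P n -
        ((Real.exp (-((∑ r, (∑ i, t i * a n i r) ^ 2) / 2)) : ℝ) : ℂ)) atTop (𝓝 0) := by
    refine squeeze_zero_norm' ?_ hup
    filter_upwards [hind, hbd, h1, h2, h3, eventually_all.2 haβ, eventually_all.2 has,
      hb0.eventually_le_const zero_lt_one] with n hi ⟨B, hB⟩ g1 g2 g3 g4 g5 g6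
    have q1 : ∀ r, |∑ i, t i * a n i r| ≤ b n := fun r =>
      (Finset.abs_sum_le_sum_abs _ _).trans (Finset.sum_le_sum fun i _ => by
        rw [abs_mul]
        exact mul_le_mul_of_nonneg_left (g4 i r) (abs_nonneg _))
    have q2 : ∑ r, |∑ i, t i * a n i r| ≤ (∑ i, |t i|) * s n := by
      calc _ ≤ ∑ r, ∑ i, |t i| * |a n i r| := Finset.sum_le_sum fun r _ =>
            (Finset.abs_sum_le_sum_abs _ _).trans_eq
              (Finset.sum_congr rfl fun i _ => abs_mul _ _)
        _ = ∑ i, |t i| * ∑ r, |a n i r| := by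
            rw [Finset.sum_comm]
            exact Finset.sum_congr rfl fun i _ => (Finset.mul_sum _ _ _).symm
        _ ≤ ∑ i, |t i| * s n :=
            Finset.sum_le_sum fun i _ => mul_le_mul_of_nonneg_left (g5 i) (abs_nonneg _)
        _ = _ := (Finset.sum_mul _ _ _).symm
    refine (norm_integral_exp_sum_sub_le (hV n) hi hB g1 g2 g3 hM _ q1 g6).trans ?_
    have := mul_le_mul_of_nonneg_left q2 (hη0 n)
    linarith
  simpa using hdiff.add hG

end CentralLimit

/-! ### Variance of Poisson counts -/

section PoissonVariance

/-- Factorial moments: `(j - lam)² = j (j - 1) + (1 - 2 lam) j + lam²`, where index shifts give the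
sums `lam²` for `j (j - 1)` and `lam` for `j`. -/
lemma hasSum_poissonWeight_mul_sq {lam : ℝ} (h : 0 ≤ lam) :
    HasSum (fun j : ℕ => poissonWeight lam j * ((j : ℝ) - lam) ^ 2) lam := by
  have h0 := hasSum_poissonWeight h
  have h1 : HasSum (fun j : ℕ => poissonWeight lam j * (j : ℝ)) lam := by
    have : HasSum (fun j : ℕ => poissonWeight lam (j + 1) * ((j + 1 : ℕ) : ℝ)) lam := by
      have := h0.mul_left lam
      rw [mul_one] at this
      refine this.congr_fun fun j => ?_
      rw [← poissonWeight_succ]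
      push_cast
      ring
    have h' := (hasSum_nat_add_iff (f := fun j : ℕ => poissonWeight lam j * (j : ℝ)) 1).1 this
    simpa using h'
  have h2 : HasSum (fun j : ℕ => poissonWeight lam j * ((j : ℝ) * (j - 1))) (lam ^ 2) := by
    have : HasSum (fun j : ℕ => poissonWeight lam (j + 2) *
        (((j + 2 : ℕ) : ℝ) * ((j + 2 : ℕ) - 1))) (lam ^ 2) := by
      have := h0.mul_left (lam ^ 2)
      rw [mul_one] at this
      refine this.congr_fun fun j => ?_
      have := poissonWeight_add_two lam j
      push_cast
      linear_combination -this
    have h' := (hasSum_nat_add_iff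
      (f := fun j : ℕ => poissonWeight lam j * ((j : ℝ) * (j - 1))) 2).1 this
    simpa [Finset.sum_range_succ] using h'
  have h3 := (h2.add (h1.mul_left (1 - 2 * lam))).add (h0.mul_left (lam ^ 2))
  convert h3 using 1
  · funext j
    ring
  · ring

variable {Ω X : Type*} [MeasurableSpace Ω] [MeasurableSpace X] {P : Measure Ω}
  [IsProbabilityMeasure P] {N : PointProcess Ω X} {Λ : Measure X}

/-- Chebyshev's inequality for the number of points in a set. -/
lemma PointProcess.IsPoisson.mul_measureReal_le (hN : N.IsPoisson P Λ) {D : Set X}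
    (hD : MeasurableSet D) (hfin : Λ D ≠ ⊤) {e : ℝ} (he : 0 ≤ e) :
    e ^ 2 * P.real {ω | e ≤ |(N.count D ω : ℝ) - Λ.real D|} ≤ Λ.real D := by
  have hlaw := hN.hasLaw_count D hD hfin
  have hs := hasSum_poissonWeight_mul_sq (lam := Λ.real D) measureReal_nonneg
  set φ : ℕ → ℝ := fun j => ((j : ℝ) - Λ.real D) ^ 2 with hφ
  have hint : Integrable φ (poissonMeasure (Λ D).toNNReal) := by
    rw [integrable_poissonMeasure_iff]
    refine hs.summable.congr fun j => ?_
    rw [hφ, Real.norm_eq_abs, abs_of_nonneg (sq_nonneg _)]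
    rfl
  have hval : ∫ j, φ j ∂(poissonMeasure (Λ D).toNNReal) = Λ.real D := by
    rw [integral_poissonMeasure]
    exact hs.tsum_eq
  rw [← hlaw.map_eq] at hint hval
  rw [integral_map hlaw.aemeasurable hint.aestronglyMeasurable] at hval
  have hint' : Integrable (fun ω => φ (N.count D ω)) P := hint.comp_aemeasurable hlaw.aemeasurable
  have := mul_meas_ge_le_integral_of_nonneg (ae_of_all _ fun ω => sq_nonneg _) hint' (e ^ 2)
  rw [hval] at this
  refine le_trans (le_of_eq ?_) this
  congr 2
  ext ω
  simp only [Set.mem_ofPred_eq]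
  rw [← sq_abs ((N.count D ω : ℝ) - Λ.real D), sq_le_sq₀ he (abs_nonneg _)]

end PoissonVariance

/-! ### Deviation and measurability of `aHat` and `cHat` -/

section IntensityEstimator

variable {E : Type*} [MeasurableSpace E] {ν : Measure E} [IsProbabilityMeasure ν] {f : E → ℝ}

lemma rate_le_mean_count {k : ℕ} {I : Fin k → Set E} (hI : IsEqualMassPartition ν I)
    (hf0 : ∀ x, 0 ≤ f x) (hfi : Integrable f ν) {b : ℝ} (hb : 0 ≤ b) (r : Fin k) :
    b * essInf f ν / k ≤ b * ∫ t in I r, f t ∂ν := by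
  have hk : (0 : ℝ) < k := by exact_mod_cast hI.pos
  rw [mul_div_assoc]
  refine mul_le_mul_of_nonneg_left ?_ hb
  rw [div_le_iff₀' hk]
  exact hI.essInf_le_mean hf0 hfi r

variable {Ω : Type*} [MeasurableSpace Ω] {P : Measure Ω} [IsProbabilityMeasure P]
  {N : PointProcess Ω (E × ℝ)} {b : ℝ}

/-- Half of `e` absorbs the oscillation error; the other half is left to Markov's inequality, with a
mean absolute fluctuation of at most `3` per cell. -/
lemma mul_measureReal_aHat_le {k : ℕ} {I : Fin k → Set E} (hI : IsEqualMassPartition ν I)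
    (hf : Measurable f) (hf0 : ∀ x, 0 ≤ f x) (hm : 0 < essInf f ν) {B : ℝ}
    (hB : ∀ᵐ x ∂ν, f x ≤ B) (hb : 0 < b) (hN : N.IsPoisson P (intensity ν f b))
    (hrate : 1 ≤ b * essInf f ν / k) {e : ℝ} (hosc : 2 * cellOsc ν f I ≤ e / 2) :
    e / 2 * P.real {ω | e ≤ |aHat N ν f I ω - ∫ t, f t ∂ν|} ≤ 3 * (k / b) := by
  have hfi := integrable_of_ae_le hf hf0 hB
  have hk : (0 : ℝ) < k := by exact_mod_cast hI.pos
  have hcp := fun r => isCellPair hf hf0 hfi hb.le hN (hI.measurableSet r)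
  have hrate' : ∀ r, 1 ≤ b * ∫ t in I r, f t ∂ν := fun r =>
    hrate.trans (rate_le_mean_count hI hf0 hfi hb.le r)
  have hVint : ∀ r, Integrable (fun ω => |cellFluct N ν f b I r ω|) P := fun r => by
    simpa [cellFluct] using ((hcp r).integrable_fluctuation_pow (zero_le_one.trans (hrate' r)) 1).abs
  have hsum : Integrable (fun ω => 1 / b * ∑ r, |cellFluct N ν f b I r ω|) P :=
    (integrable_finsetSum _ fun r _ => hVint r).const_mul _
  have h1 := mul_meas_ge_le_integral_of_nonneg (ae_of_all P fun ω => by positivity) hsum (e / 2)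
  have h2 : ∫ ω, 1 / b * ∑ r, |cellFluct N ν f b I r ω| ∂P ≤ 3 * (k / b) := by
    rw [integral_const_mul, integral_finsetSum _ fun r _ => hVint r]
    calc 1 / b * ∑ r, ∫ ω, |cellFluct N ν f b I r ω| ∂P ≤ 1 / b * ∑ _r : Fin k, 3 := by
          gcongr with r
          exact (hcp r).integral_abs_fluctuation_le (hrate' r)
      _ = 3 * (k / b) := by
          simp
          ring
  have hae : ∀ᵐ ω ∂P, |aHat N ν f I ω - ∫ t, f t ∂ν| ≤
      e / 2 + 1 / b * ∑ r, |cellFluct N ν f b I r ω| := by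
    filter_upwards [ae_abs_correctedMax_sub_cellFluct_le hI hf hf0 hm hB hb hN] with ω hω
    -- The cell mass `1 / k` times the coefficient `k / b` gives `1 / b`.
    have e1 : aHat N ν f I ω - ∫ t, f t ∂ν = ∑ r, (k : ℝ)⁻¹ * (correctedMax N f (I r) ω -
        (k * ∫ t in I r, f t ∂ν + k / b * cellFluct N ν f b I r ω)) +
        1 / b * ∑ r, cellFluct N ν f b I r ω := by
      rw [aHat, ← hI.sum_setIntegral hfi, Finset.mul_sum, ← Finset.sum_sub_distrib,
        ← Finset.sum_add_distrib]
      refine Finset.sum_congr rfl fun r _ => ?_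
      rw [hI.mass]
      field_simp
      ring
    rw [e1]
    refine (abs_add_le _ _).trans (add_le_add ?_ ?_)
    · refine (Finset.abs_sum_le_sum_abs _ _).trans ?_
      calc _ ≤ ∑ _r : Fin k, (k : ℝ)⁻¹ * (2 * cellOsc ν f I) := by
            refine Finset.sum_le_sum fun r _ => ?_
            rw [abs_mul, abs_of_nonneg (by positivity)]
            exact mul_le_mul_of_nonneg_left (hω r) (by positivity)
        _ = 2 * cellOsc ν f I := by
            simp
            field_simp
        _ ≤ e / 2 := hosc
    · rw [abs_mul, abs_of_nonneg (by positivity)]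
      gcongr
      exact Finset.abs_sum_le_sum_abs _ _
  rcases le_or_gt e 0 with he | he
  · have : 0 ≤ 3 * (k / b) := by positivity
    exact (mul_nonpos_of_nonpos_of_nonneg (by linarith) measureReal_nonneg).trans this
  refine le_trans ?_ (h1.trans h2)
  refine mul_le_mul_of_nonneg_left ?_ (by linarith)
  refine ENNReal.toReal_mono (measure_ne_top _ _) (measure_mono_ae ?_)
  filter_upwards [hae] with ω hω hle
  change e / 2 ≤ 1 / b * ∑ r, |cellFluct N ν f b I r ω|
  have hle' : e ≤ |aHat N ν f I ω - ∫ t, f t ∂ν| := hle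
  linarith

lemma measurable_aHat {k : ℕ} {I : Fin k → Set E} (hI : IsEqualMassPartition ν I)
    (hf : Measurable f) : Measurable (aHat N ν f I) := by
  unfold aHat
  exact Finset.measurable_sum _ fun r _ =>
    (measurable_correctedMax hf (hI.measurableSet r)).const_mul _

lemma measurable_cHat {k : ℕ} {I : Fin k → Set E} (hI : IsEqualMassPartition ν I)
    (hf : Measurable f) (n : ℕ) : Measurable (cHat N ν f I n) := by
  have h1 : Measurable fun ω => (N.count (hypograph f Set.univ) ω : ℝ) :=
    measurable_from_nat.comp (measurable_count N (measurableSet_hypograph hf MeasurableSet.univ))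
  exact h1.div ((measurable_aHat hI hf).const_mul _)

end IntensityEstimator

/-! ### Consistency of the estimated intensity constant -/

section Consistency

variable {E : Type*} [MeasurableSpace E] {ν : Measure E} [IsProbabilityMeasure ν] {f : E → ℝ}
  {Ω : ℕ → Type*} [∀ n, MeasurableSpace (Ω n)] {P : (n : ℕ) → Measure (Ω n)}
  [∀ n, IsProbabilityMeasure (P n)] {N : (n : ℕ) → PointProcess (Ω n) (E × ℝ)}
  {k : ℕ → ℕ} {I : (n : ℕ) → Fin (k n) → Set E} {c : ℝ}

lemma tendsto_cellOsc (hI : ∀ n, IsEqualMassPartition ν (I n)) (hf : Measurable f)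
    (hf0 : ∀ x, 0 ≤ f x) {B : ℝ} (hB : ∀ᵐ x ∂ν, f x ≤ B)
    (hk_log : Tendsto (fun n : ℕ => (n : ℝ)⁻¹ * k n * Real.log n) atTop (𝓝 0))
    (hosc : Tendsto (fun n : ℕ => n * (k n : ℝ)⁻¹ * cellOsc ν f (I n)) atTop (𝓝 0)) :
    Tendsto (fun n => cellOsc ν f (I n)) atTop (𝓝 0) := by
  refine squeeze_zero' (Eventually.of_forall fun n => (hI n).cellOsc_nonneg hf hf0 hB) ?_ hosc
  filter_upwards [(tendsto_div_atTop_of_log (fun n => (hI n).pos) hk_log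
    one_pos).eventually_ge_atTop 1] with n hn
  rw [one_mul, div_eq_mul_inv] at hn
  exact le_mul_of_one_le_left ((hI n).cellOsc_nonneg hf hf0 hB) hn

/-- The estimator of the intensity constant is consistent. -/
lemma tendsto_measure_cHat (hI : ∀ n, IsEqualMassPartition ν (I n)) (hf : Measurable f)
    (hf0 : ∀ x, 0 ≤ f x) (hm : 0 < essInf f ν) {B : ℝ} (hB : ∀ᵐ x ∂ν, f x ≤ B) (hc : 0 < c)
    (hN : ∀ n, (N n).IsPoisson (P n) (intensity ν f (n * c)))
    (hk_log : Tendsto (fun n : ℕ => (n : ℝ)⁻¹ * k n * Real.log n) atTop (𝓝 0))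
    (hosc : Tendsto (fun n : ℕ => n * (k n : ℝ)⁻¹ * cellOsc ν f (I n)) atTop (𝓝 0))
    {e : ℝ} (he : 0 < e) :
    Tendsto (fun n => P n {ω | e ≤ |cHat (N n) ν f (I n) n ω / c - 1|}) atTop (𝓝 0) := by
  have hfi := integrable_of_ae_le hf hf0 hB
  set a := ∫ t, f t ∂ν with ha_def
  have ha : 0 < a := by
    refine hm.trans_le ?_
    have := integral_mono_ae (integrable_const (essInf f ν)) hfi (ae_essInf_le_self (ν := ν) hf0)
    simpa using this
  -- `ĉ / c` is a function of `N(S) / n` and `â` that is continuous at `(c a, a)`, so convergence in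
  -- probability of both suffices.
  have hcont : ContinuousAt (fun q : ℝ × ℝ => q.1 / q.2 / c) (c * a, a) := by
    have : (c * a, a).2 ≠ 0 := ha.ne'
    fun_prop (disch := first | assumption | exact hc.ne')
  obtain ⟨d, hd, hdc⟩ := Metric.continuousAt_iff.1 hcont e he
  have hval : c * a / a / c = 1 := by field_simp
  have hA : Tendsto (fun n => (P n).real {ω | d ≤
      |((N n).count (hypograph f Set.univ) ω : ℝ) / n - c * a|}) atTop (𝓝 0) := by
    -- Chebyshev: variance `n c a` against the squared deviation `(d n)²`.
    have hlim : Tendsto (fun n : ℕ => c * a / d ^ 2 * (n : ℝ)⁻¹) atTop (𝓝 0) := by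
      simpa using tendsto_inv_atTop_nhds_zero_nat.const_mul (c * a / d ^ 2)
    refine squeeze_zero' (Eventually.of_forall fun n => measureReal_nonneg) ?_ hlim
    filter_upwards [eventually_gt_atTop 0] with n hn
    have hn0 : (0 : ℝ) < n := by exact_mod_cast hn
    have hb : 0 ≤ n * c := by positivity
    have h1 := (hN n).mul_measureReal_le (measurableSet_hypograph hf MeasurableSet.univ)
      (intensity_hypograph_ne_top hf hf0 hfi MeasurableSet.univ) (e := d * n) (by positivity)
    have h2 := intensity_real_hypograph hf hf0 hfi hb MeasurableSet.univ zero_le_one le_rfl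
    simp only [one_mul, setIntegral_univ] at h2
    rw [h2, ← ha_def] at h1
    have e1 : {ω | d * n ≤ |((N n).count (hypograph f Set.univ) ω : ℝ) - n * c * a|} =
        {ω | d ≤ |((N n).count (hypograph f Set.univ) ω : ℝ) / n - c * a|} := by
      ext ω
      simp only [Set.mem_ofPred_eq]
      have : ((N n).count (hypograph f Set.univ) ω : ℝ) / n - c * a =
          (((N n).count (hypograph f Set.univ) ω : ℝ) - n * c * a) / n := by
        field_simp
      rw [this, abs_div, abs_of_pos hn0, le_div_iff₀ hn0]
    rw [e1] at h1
    have h3 : 0 < (d * n) ^ 2 := by positivity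
    rw [← le_div_iff₀' h3] at h1
    refine h1.trans (le_of_eq ?_)
    field_simp
  have hBt : Tendsto (fun n => (P n).real {ω | d ≤ |aHat (N n) ν f (I n) ω - a|}) atTop (𝓝 0) := by
    have hlim : Tendsto (fun n : ℕ => 6 / (c * d) * ((k n : ℝ) / n)) atTop (𝓝 0) := by
      simpa using (tendsto_div_of_log hk_log).const_mul (6 / (c * d))
    refine squeeze_zero' (Eventually.of_forall fun n => measureReal_nonneg) ?_ hlim
    filter_upwards [eventually_gt_atTop 0,
      (tendsto_cellOsc hI hf hf0 hB hk_log hosc).eventually_le_const (by positivity : 0 < d / 4),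
      (tendsto_div_atTop_of_log (fun n => (hI n).pos) hk_log
        (mul_pos hc hm)).eventually_ge_atTop 1] with n hn h1 h2
    have hn0 : (0 : ℝ) < n := by exact_mod_cast hn
    have h3 := mul_measureReal_aHat_le (hI n) hf hf0 hm hB (mul_pos hn0 hc) (hN n)
      (h2.trans_eq (by ring)) (e := d) (by linarith)
    rw [← le_div_iff₀' (by positivity)] at h3
    refine h3.trans (le_of_eq ?_)
    field_simp
    ring
  rw [← ENNReal.tendsto_toReal_iff (fun n => measure_ne_top _ _) ENNReal.zero_ne_top,
    ENNReal.toReal_zero]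
  refine squeeze_zero (fun n => ENNReal.toReal_nonneg) (fun n => ?_) (by simpa using hA.add hBt)
  refine le_trans ?_ (measureReal_union_le _ _)
  refine measureReal_mono ?_
  intro ω hω
  by_contra hcon
  simp only [Set.mem_union, Set.mem_ofPred_eq, not_or, not_le] at hcon hω
  have := hdc (x := (((N n).count (hypograph f Set.univ) ω : ℝ) / n, aHat (N n) ν f (I n) ω)) (by
    rw [Prod.dist_eq, max_lt_iff, Real.dist_eq, Real.dist_eq]
    exact hcon)
  rw [Real.dist_eq, hval] at this
  rw [cHat, ← div_div] at hω
  exact absurd this (not_lt.2 hω)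

end Consistency

/-! ### Asymptotic normality of linear combinations of corrected maxima -/

section Estimators

lemma euclideanNorm_le_sum {p : ℕ} (v : EuclideanSpace ℝ (Fin p)) : ‖v‖ ≤ ∑ j, |v j| := by
  rw [EuclideanSpace.norm_eq, Real.sqrt_le_left (Finset.sum_nonneg fun _ _ => abs_nonneg _)]
  simp_rw [Real.norm_eq_abs]
  exact Finset.sum_sq_le_sq_sum_of_nonneg fun _ _ => abs_nonneg _

variable {E : Type*} [MeasurableSpace E] {ν : Measure E} [IsProbabilityMeasure ν] {f : E → ℝ}
  {Ω : ℕ → Type*} [∀ n, MeasurableSpace (Ω n)] {P : (n : ℕ) → Measure (Ω n)}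
  [∀ n, IsProbabilityMeasure (P n)] {N : (n : ℕ) → PointProcess (Ω n) (E × ℝ)}
  {k : ℕ → ℕ} {I : (n : ℕ) → Fin (k n) → Set E} {c : ℝ}
  {K : ℕ → E → E → ℝ} {F : Set E} {σ : E → E → ℝ}

/-- The stochastic part of the estimators is asymptotically normal. -/
lemma tendstoInDistribution_cellFluct (hf : Measurable f) (hf0 : ∀ x, 0 ≤ f x) (hc : 0 < c)
    (hN : ∀ n, (N n).IsPoisson (P n) (intensity ν f (n * c)))
    (hI : ∀ n, IsEqualMassPartition ν (I n))
    (hKint : ∀ n, ∀ x ∈ F, Integrable (K n x) ν)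
    (hKbdd : ∀ x ∈ F, ∀ᶠ n in atTop, ∃ B, ∀ t, |K n x t| ≤ B)
    (hk_log : Tendsto (fun n : ℕ => (n : ℝ)⁻¹ * k n * Real.log n) atTop (𝓝 0))
    (hm : 0 < essInf f ν) {B : ℝ} (hB : ∀ᵐ x ∂ν, f x ≤ B)
    (hcov : ∀ x₁ ∈ F, ∀ x₂ ∈ F, Tendsto (fun n => ∑ r, cellWeight ν (I n) (K n x₁) r *
      cellWeight ν (I n) (K n x₂) r) atTop (𝓝 (σ x₁ x₂)))
    (hK3 : ∀ x ∈ F, Tendsto (fun n =>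
      (√(k n : ℝ))⁻¹ * (norm2 ν (K n x))⁻¹ * normSup (K n x)) atTop (𝓝 0))
    {p : ℕ} (x : Fin p → E) (hx : ∀ j, x j ∈ F) :
    TendstoInDistribution (fun n ω => (WithLp.toLp 2 fun j =>
        ∑ r, cellWeight ν (I n) (K n (x j)) r * cellFluct (N n) ν f (n * c) (I n) r ω :
        EuclideanSpace ℝ (Fin p)))
      atTop id P (multivariateGaussian 0 (Matrix.of fun i j => σ (x i) (x j))) := by
  have hfi := integrable_of_ae_le hf hf0 hB
  have hb : ∀ n : ℕ, 0 ≤ n * c := fun n => by positivity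
  have hcp := fun n r => isCellPair hf hf0 hfi (hb n) (hN n) ((hI n).measurableSet r)
  -- A lower bound for the mean count, common to all cells.
  set l : ℕ → ℝ := fun n => c * essInf f ν * (n / (k n : ℝ)) with hl_def
  have hl : Tendsto l atTop atTop :=
    tendsto_div_atTop_of_log (fun n => (hI n).pos) hk_log (mul_pos hc hm)
  have hrate : ∀ n r, l n ≤ n * c * ∫ t in I n r, f t ∂ν := fun n r =>
    le_trans (le_of_eq (by rw [hl_def]; ring)) (rate_le_mean_count (hI n) hf0 hfi (hb n) r)
  have hnn : ∀ n r, 0 ≤ n * c * ∫ t in I n r, f t ∂ν := fun n r =>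
    mul_nonneg (hb n) (integral_nonneg hf0)
  refine tendstoInDistribution_weighted_sum
    (β := fun j n => (√(k n : ℝ))⁻¹ * (norm2 ν (K n (x j)))⁻¹ * normSup (K n (x j)))
    (s := fun n => √(k n : ℝ)) (η := fun n => 2 * Real.exp (-(l n / 2))) (δ := fun n => 4 / l n)
    (M := 53) (fun i j => hcov _ (hx i) _ (hx j)) (fun j => hK3 _ (hx j)) (fun j => ?_)
    (fun j => ?_) (fun n r => (hcp n r).measurable_fluctuation) ?_ ?_ ?_ ?_ ?_ (by norm_num)
    (fun n => by positivity) ?_ (tendsto_const_nhds.div_atTop hl)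
  · filter_upwards [hKbdd _ (hx j)] with n ⟨C, hC⟩ r
    exact abs_cellWeight_le (hI n) (hKint n _ (hx j)) hC r
  · filter_upwards [hKbdd _ (hx j)] with n ⟨C, hC⟩
    exact sum_abs_cellWeight_le (hI n) (hKint n _ (hx j)) hC
  · exact Eventually.of_forall fun n =>
      iIndepFun_fluctuation hf hf0 (hN n) (hI n).measurableSet (hI n).disjoint _
  · refine Eventually.of_forall fun n => ⟨n * c * ∫ t, f t ∂ν, fun r ω => ?_⟩
    refine ((hcp n r).abs_fluctuation_le (hnn n r) ω).trans ?_
    exact mul_le_mul_of_nonneg_left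
      (setIntegral_le_integral hfi (ae_of_all _ hf0)) (hb n)
  · exact Eventually.of_forall fun n r =>
      (hcp n r).abs_integral_fluctuation_le (hnn n r) (hrate n r)
  · filter_upwards [hl.eventually_ge_atTop 1] with n hn r
    exact (hcp n r).abs_integral_fluctuation_sq_sub_le (zero_lt_one.trans_le hn) (hrate n r)
  · filter_upwards [hl.eventually_ge_atTop 1] with n hn r
    exact (hcp n r).integral_abs_fluctuation_pow_three_le (hn.trans (hrate n r))
  · have := (tendsto_sqrt_mul_exp_of_log (fun n => (hI n).pos) hk_log
      (mul_pos hc hm)).const_mul 2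
    rw [mul_zero] at this
    refine this.congr fun n => ?_
    rw [hl_def]
    ring

/-- Asymptotic normality of linear combinations of the corrected maxima whose weights are close to
the cell integrals of the kernel, with known and with estimated intensity constant. -/
lemma tendstoInDistribution_linear_estimator (hf : Measurable f) (hf0 : ∀ x, 0 ≤ f x) (hc : 0 < c)
    (hN : ∀ n, (N n).IsPoisson (P n) (intensity ν f (n * c)))
    (hI : ∀ n, IsEqualMassPartition ν (I n))
    (hKint : ∀ n, ∀ x ∈ F, Integrable (K n x) ν)
    (hKbdd : ∀ x ∈ F, ∀ᶠ n in atTop, ∃ B, ∀ t, |K n x t| ≤ B)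
    (hk_log : Tendsto (fun n : ℕ => (n : ℝ)⁻¹ * k n * Real.log n) atTop (𝓝 0))
    (hm : 0 < essInf f ν) {B : ℝ} (hB : ∀ᵐ x ∂ν, f x ≤ B)
    (hosc : Tendsto (fun n : ℕ => n * (k n : ℝ)⁻¹ * cellOsc ν f (I n)) atTop (𝓝 0))
    (hcov : ∀ x₁ ∈ F, ∀ x₂ ∈ F, Tendsto (fun n => ∑ r, cellWeight ν (I n) (K n x₁) r *
      cellWeight ν (I n) (K n x₂) r) atTop (𝓝 (σ x₁ x₂)))
    (hK3 : ∀ x ∈ F, Tendsto (fun n =>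
      (√(k n : ℝ))⁻¹ * (norm2 ν (K n x))⁻¹ * normSup (K n x)) atTop (𝓝 0))
    (hK4 : ∀ x ∈ F, Tendsto (fun n : ℕ =>
      n * (√(k n : ℝ))⁻¹ * (norm2 ν (K n x))⁻¹ *
        max (Psi ν f (K n) x) (cellOsc ν f (I n) * norm1 ν (K n x))) atTop (𝓝 0))
    (u : (n : ℕ) → E → Fin (k n) → ℝ)
    (hu : ∀ x ∈ F, Tendsto (fun n : ℕ => n * (√(k n : ℝ))⁻¹ * (norm2 ν (K n x))⁻¹ *
      ∑ r, |u n x r - ∫ t in I n r, K n x t ∂ν|) atTop (𝓝 0))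
    {p : ℕ} (x : Fin p → E) (hx : ∀ j, x j ∈ F) :
    TendstoInDistribution (fun (n : ℕ) (ω : Ω n) => (WithLp.toLp 2 fun j =>
        n * c * (√(k n : ℝ))⁻¹ * (norm2 ν (K n (x j)))⁻¹ *
          (∑ r, u n (x j) r * correctedMax (N n) f (I n r) ω - f (x j)) :
        EuclideanSpace ℝ (Fin p)))
      atTop id P (multivariateGaussian 0 (Matrix.of fun i j => σ (x i) (x j))) ∧
    TendstoInDistribution (fun (n : ℕ) (ω : Ω n) => (WithLp.toLp 2 fun j =>
        n * cHat (N n) ν f (I n) n ω * (√(k n : ℝ))⁻¹ * (norm2 ν (K n (x j)))⁻¹ *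
          (∑ r, u n (x j) r * correctedMax (N n) f (I n r) ω - f (x j)) :
        EuclideanSpace ℝ (Fin p)))
      atTop id P (multivariateGaussian 0 (Matrix.of fun i j => σ (x i) (x j))) := by
  have hmain := tendstoInDistribution_cellFluct hf hf0 hc hN hI hKint hKbdd hk_log hm hB hcov hK3
    x hx
  have hU : ∀ n r, Measurable (correctedMax (N n) f (I n r)) := fun n r =>
    measurable_correctedMax hf ((hI n).measurableSet r)
  have hfirst : TendstoInDistribution (fun (n : ℕ) (ω : Ω n) => (WithLp.toLp 2 fun j =>
        n * c * (√(k n : ℝ))⁻¹ * (norm2 ν (K n (x j)))⁻¹ *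
          (∑ r, u n (x j) r * correctedMax (N n) f (I n r) ω - f (x j)) :
        EuclideanSpace ℝ (Fin p)))
      atTop id P (multivariateGaussian 0 (Matrix.of fun i j => σ (x i) (x j))) := by
    -- `ε` is the bound of `ae_abs_weighted_sum_sub_le` times the standardising factor, summed over
    -- the coordinates.
    refine TendstoInDistribution.of_dist_le hmain (fun n => by
        have := hU n
        exact Measurable.aemeasurable (by fun_prop))
      (ε := fun n => ∑ j, c * ((2 * cellOsc ν f (I n) + 2 * B) *
        (n * (√(k n : ℝ))⁻¹ * (norm2 ν (K n (x j)))⁻¹ *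
          ∑ r, |u n (x j) r - ∫ t in I n r, K n (x j) t ∂ν|) +
        4 * (n * (√(k n : ℝ))⁻¹ * (norm2 ν (K n (x j)))⁻¹ *
          max (Psi ν f (K n) (x j)) (cellOsc ν f (I n) * norm1 ν (K n (x j)))))) ?_ ?_
    · have h1 := tendsto_cellOsc hI hf hf0 hB hk_log hosc
      have h2 := tendsto_finsetSum Finset.univ fun j _ =>
        ((((h1.const_mul 2).add_const (2 * B)).mul (hu _ (hx j))).add
          ((hK4 _ (hx j)).const_mul 4)).const_mul c
      simpa using h2
    · filter_upwards [eventually_gt_atTop 0, eventually_all.2 fun j => hKbdd _ (hx j)] with n hn hC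
      choose C hC using hC
      have hn0 : (0 : ℝ) < n := by exact_mod_cast hn
      have hk : (0 : ℝ) < k n := by exact_mod_cast (hI n).pos
      have hae := ae_all_iff.2 fun j => ae_abs_weighted_sum_sub_le (hI n) hf hf0 hm hB
        (mul_pos hn0 hc) (hN n) (hKint n _ (hx j)) (hC j) (u n (x j))
      filter_upwards [hae] with ω hω
      refine (euclideanNorm_le_sum _).trans (Finset.sum_le_sum fun j _ => ?_)
      have hcoef : 0 ≤ n * c * (√(k n : ℝ))⁻¹ * (norm2 ν (K n (x j)))⁻¹ := by
        have := norm2_nonneg (ν := ν) (K n (x j))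
        positivity
      -- The factor `n c / √k` turns `k / (n c)` into `√k`, the factor in `cellWeight`.
      have e : n * c * (√(k n : ℝ))⁻¹ * (norm2 ν (K n (x j)))⁻¹ *
            (∑ r, u n (x j) r * correctedMax (N n) f (I n r) ω - f (x j)) -
          ∑ r, cellWeight ν (I n) (K n (x j)) r * cellFluct (N n) ν f (n * c) (I n) r ω =
          n * c * (√(k n : ℝ))⁻¹ * (norm2 ν (K n (x j)))⁻¹ *
            (∑ r, u n (x j) r * correctedMax (N n) f (I n r) ω - f (x j) - k n / (n * c) *
              ∑ r, (∫ t in I n r, K n (x j) t ∂ν) * cellFluct (N n) ν f (n * c) (I n) r ω) := by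
        simp_rw [cellWeight, mul_assoc _ (∫ t in I n _, K n (x j) t ∂ν)]
        rw [← Finset.mul_sum, mul_sub]
        generalize ∑ r, (∫ t in I n r, K n (x j) t ∂ν) *
          cellFluct (N n) ν f (n * c) (I n) r ω = T
        field_simp
        rw [Real.sq_sqrt hk.le]
        ring
      simp only [PiLp.sub_apply]
      rw [e, abs_mul, abs_of_nonneg hcoef]
      refine (mul_le_mul_of_nonneg_left (hω j) hcoef).trans (le_of_eq ?_)
      ring
  refine ⟨hfirst, ?_⟩
  -- Estimating `c` multiplies the whole vector by `ĉ / c`.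
  have := TendstoInDistribution.smul_of_tendsto_one hfirst
    (Y := fun n ω => cHat (N n) ν f (I n) n ω / c)
    (fun n => (measurable_cHat (hI n) hf n).div_const c)
    (fun e he => tendsto_measure_cHat hI hf hf0 hm hB hc hN hk_log hosc he)
  convert! this using 3 with n ω
  ext j
  simp only [PiLp.smul_apply, smul_eq_mul]
  field_simp

end Estimators

end PoissonBoundary

end

/-! ### The two estimators as linear combinations -/

theorem theorem2 {E : Type*} [MeasurableSpace E] (ν : Measure E) [IsProbabilityMeasure ν]
    -- the boundary function and the constant in the intensity
    (f : E → ℝ) (hf : Measurable f) (hf0 : ∀ x, 0 ≤ f x) (c : ℝ) (hc : 0 < c)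
    -- the Poisson point processes, each on a probability space of its own
    {Ω : ℕ → Type*} [∀ n, MeasurableSpace (Ω n)]
    (P : (n : ℕ) → Measure (Ω n)) [∀ n, IsProbabilityMeasure (P n)]
    (N : (n : ℕ) → PointProcess (Ω n) (E × ℝ))
    (hN : ∀ n, (N n).IsPoisson (P n) (intensity ν f (n * c)))
    -- the equal-mass partitions
    (k : ℕ → ℕ) (I : (n : ℕ) → Fin (k n) → Set E) (hI : ∀ n, IsEqualMassPartition ν (I n))
    -- the kernels, the set `F` and the limit covariance function
    (K : ℕ → E → E → ℝ) (F : Set E) (σ : E → E → ℝ)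
    -- the estimators and the conditions are meaningful at the points of `F`
    (hKint : ∀ n, ∀ x ∈ F, Integrable (K n x) ν)
    (hKbdd : ∀ x ∈ F, ∀ᶠ n in atTop, ∃ B, ∀ t, |K n x t| ≤ B)
    (hKpos : ∀ x ∈ F, ∀ᶠ n in atTop, norm2 ν (K n x) ≠ 0)
    -- (H'.1)
    (hk_mono : Monotone k) (hk_top : Tendsto k atTop atTop)
    (hk_log : Tendsto (fun n : ℕ => (n : ℝ)⁻¹ * k n * Real.log n) atTop (𝓝 0))
    -- (H.2)
    (hm : 0 < essInf f ν) (hM : ∃ B, ∀ᵐ x ∂ν, f x ≤ B)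
    (hosc : Tendsto (fun n : ℕ => n * (k n : ℝ)⁻¹ * cellOsc ν f (I n)) atTop (𝓝 0))
    -- (K.0)
    (hK0 : ∀ n, 1 ≤ n → Integrable (Function.uncurry (K n)) (ν.prod ν))
    -- (K.1)
    (hK1 : ∀ x₁ ∈ F, ∀ x₂ ∈ F,
      (fun n => Gam (I n) (K n x₁) * norm1 ν (K n x₂))
        =o[atTop] (fun n => norm2 ν (K n x₁) * norm2 ν (K n x₂)))
    -- (K.2)
    (hK2 : ∀ x₁ ∈ F, ∀ x₂ ∈ F,
      Tendsto (fun n => (∫ t, K n x₁ t * K n x₂ t ∂ν) *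
        (norm2 ν (K n x₁) * norm2 ν (K n x₂))⁻¹) atTop (𝓝 (σ x₁ x₂)))
    -- (K.3)
    (hK3 : ∀ x ∈ F, Tendsto (fun n =>
      (√(k n : ℝ))⁻¹ * (norm2 ν (K n x))⁻¹ * normSup (K n x)) atTop (𝓝 0))
    -- (K.4)
    (hK4 : ∀ x ∈ F, Tendsto (fun n : ℕ =>
      n * (√(k n : ℝ))⁻¹ * (norm2 ν (K n x))⁻¹ *
        max (Psi ν f (K n) x) (cellOsc ν f (I n) * norm1 ν (K n x))) atTop (𝓝 0)) :
    -- the limit matrices are covariance matrices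
    (∀ (p : ℕ) (x : Fin p → E), (∀ j, x j ∈ F) →
      (Matrix.of fun i j => σ (x i) (x j)).PosSemidef) ∧
    -- a), and c) for the kernel estimator
    (∀ (p : ℕ) (x : Fin p → E), (∀ j, x j ∈ F) →
      TendstoInDistribution
        (fun (n : ℕ) (ω : Ω n) => (WithLp.toLp 2 fun j =>
          n * c * (√(k n : ℝ))⁻¹ * (norm2 ν (K n (x j)))⁻¹ *
            (kernelEstimator (N n) ν f (I n) (K n) (x j) ω - f (x j)) :
          EuclideanSpace ℝ (Fin p)))
        atTop id P (multivariateGaussian 0 (Matrix.of fun i j => σ (x i) (x j))) ∧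
      TendstoInDistribution
        (fun (n : ℕ) (ω : Ω n) => (WithLp.toLp 2 fun j =>
          n * cHat (N n) ν f (I n) n ω * (√(k n : ℝ))⁻¹ * (norm2 ν (K n (x j)))⁻¹ *
            (kernelEstimator (N n) ν f (I n) (K n) (x j) ω - f (x j)) :
          EuclideanSpace ℝ (Fin p)))
        atTop id P (multivariateGaussian 0 (Matrix.of fun i j => σ (x i) (x j)))) ∧
    -- b), and c) for the simplified estimator, for any choice of nodes satisfying (K.5)
    (∀ ξ : (n : ℕ) → Fin (k n) → E, (∀ n r, ξ n r ∈ I n r) →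
      (∀ x ∈ F, Tendsto (fun n : ℕ =>
        n * (√(k n : ℝ))⁻¹ * (norm2 ν (K n x))⁻¹ *
          ∑ r, |∫ t in I n r, (K n x t - K n x (ξ n r)) ∂ν|) atTop (𝓝 0)) →
      ∀ (p : ℕ) (x : Fin p → E), (∀ j, x j ∈ F) →
      TendstoInDistribution
        (fun (n : ℕ) (ω : Ω n) => (WithLp.toLp 2 fun j =>
          n * c * (√(k n : ℝ))⁻¹ * (norm2 ν (K n (x j)))⁻¹ *
            (simplifiedEstimator (N n) ν f (I n) (K n) (ξ n) (x j) ω - f (x j)) :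
          EuclideanSpace ℝ (Fin p)))
        atTop id P (multivariateGaussian 0 (Matrix.of fun i j => σ (x i) (x j))) ∧
      TendstoInDistribution
        (fun (n : ℕ) (ω : Ω n) => (WithLp.toLp 2 fun j =>
          n * cHat (N n) ν f (I n) n ω * (√(k n : ℝ))⁻¹ * (norm2 ν (K n (x j)))⁻¹ *
            (simplifiedEstimator (N n) ν f (I n) (K n) (ξ n) (x j) ω - f (x j)) :
          EuclideanSpace ℝ (Fin p)))
        atTop id P (multivariateGaussian 0 (Matrix.of fun i j => σ (x i) (x j)))) := by
  obtain ⟨B, hB⟩ := hM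
  have hcov : ∀ x₁ ∈ F, ∀ x₂ ∈ F, Tendsto (fun n => ∑ r, cellWeight ν (I n) (K n x₁) r *
      cellWeight ν (I n) (K n x₂) r) atTop (𝓝 (σ x₁ x₂)) := fun x₁ h₁ x₂ h₂ =>
    tendsto_sum_cellWeight_mul hI (fun n => hKint n x₁ h₁) (fun n => hKint n x₂ h₂) (hKbdd x₁ h₁)
      (hKpos x₁ h₁) (hKpos x₂ h₂) (hK1 x₁ h₁ x₂ h₂) (hK2 x₁ h₁ x₂ h₂)
  refine ⟨fun p x hx => posSemidef_of_tendsto_gram fun i j => hcov _ (hx i) _ (hx j),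
    fun p x hx => ?_, fun ξ hξ hK5 p x hx => ?_⟩
  -- Here the weights are the cell integrals themselves, so the weight error is zero.
  · have := tendstoInDistribution_linear_estimator hf hf0 hc hN hI hKint hKbdd hk_log hm hB hosc
      hcov hK3 hK4 (fun n x r => ∫ t in I n r, K n x t ∂ν) (fun x _ => by simp) x hx
    have e : ∀ n j ω, kernelEstimator (N n) ν f (I n) (K n) (x j) ω =
        ∑ r, (∫ t in I n r, K n (x j) t ∂ν) * correctedMax (N n) f (I n r) ω := fun n j ω =>
      (hI n).kernelEstimator_eq (hKint n _ (hx j)) ω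
    simp_rw [e]
    exact this
  · refine tendstoInDistribution_linear_estimator hf hf0 hc hN hI hKint hKbdd hk_log hm hB hosc
      hcov hK3 hK4 (fun n x r => ν.real (I n r) * K n x (ξ n r)) (fun x hx => ?_) x hx
    -- Cell mass times node value minus cell integral is, up to sign, the integral in `hK5`.
    refine (hK5 x hx).congr fun n => ?_
    congr 1
    refine Finset.sum_congr rfl fun r _ => ?_
    rw [integral_sub (hKint n x hx).integrableOn (integrable_const _).integrableOn,
      setIntegral_const, smul_eq_mul, abs_sub_comm]
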